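/- **Theorem (Fixing the Ordered List of the Roots).** Let $\mathbf K$ be an ordered field, $\mathbf R$ a real closed field extending $\mathbf K$ (as an ordered field), $u=(u_1,\dots,u_k)$, and let $\mathcal Q$ be a finite family of polynomials in $\mathbf K[u,y]=\mathbf K[u][y]$ that are monic in $y$. *Notation.* For a set $S$ of polynomials, a sign condition on $S$ is an element of $\{-1,0,1\}^S$; for $S\subset\mathbf K[u]$ the realization of $\tau\in\{-1,0,1\}^S$ is $\mathrm{Real}(\tau,\mathbf R)=\{\upsilon\in\mathbf R^k\mid \mathrm{sign}(f(\upsilon))=\tau(f)\ \forall f\in S\}$, and $\tau$ is realizable if this set is non-empty. For $P$ monic in $y$ with $\deg_yP=p$, let $P^{(h)}$ be its $h$-th derivative in $y$, $\mathrm{Der}(P)=\{P^{(1)},\dots,P^{(p-1)}\}$, $\mathrm{Der}_+(P)=\{P\}\cup\mathrm{Der}(P)$ and $\mathrm{Der}_+(\mathcal Q)=\bigcup_{P\in\mathcal Q}\mathrm{Der}_+(P)$. *The eliminating family.* $\mathrm{HMi}(P;A)\subset\mathbf K[u]$ is the set of the leading principal minors of sizes $1,\dots,p$ of the Hermite matrix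 of $P$ and $A$, i.e. of the $p\times p$ matrix whose $(i,j)$ entry is the trace of multiplication by $A\,y^{i+j-2}$ on $\mathbf K[u][y]/(P)$. $\mathrm{PDer}_i(P)$ is the set of products $\prod_{1\le h\le p-1}(P^{(h)})^{\alpha_h}$ with $\alpha_h\in\{0,1,2\}$ and at most $i$ non-zero $\alpha_h$; $\mathrm{PDer}_i(P;Q)=\{AB\mid A\in\mathrm{PDer}_i(P),\,B\in\{Q,Q^2\}\}$. With $\mathrm{bit}\{p\}$ the number of binary digits of $p$, $$\mathrm{ThElim}(P)=\bigcup_{A\in\mathrm{PDer}_{\mathrm{bit}\{p\}}(P)}\mathrm{HMi}(P;A),\qquad \mathrm{ThElim}(P;Q)=\bigcup_{A\in\mathrm{PDer}_{\mathrm{bit}\{p\}-1}(P;Q)}\mathrm{HMi}(P;A),$$ $$\mathrm{Elim}(\mathcal Q)=\bigcup_{P\in\mathcal Q}\mathrm{ThElim}(P)\ \cup\bigcup_{P\in\mathcal Q,\ Q\in\mathrm{Der}_+(\mathcal Q)\setminus\mathrm{Der}_+(P)}\mathrm{ThElim}(P;Q).$$ *Descriptions of roots.* For a sign condition $\eta$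 on $\mathrm{Der}_+(P)$ write $\eta(h)=\eta(P^{(h)})$ for $0\le h<p$ and $\eta(p)=1$. Put $\eta\prec_P\eta'$ if $\eta(q)\ne\eta'(q)$ for some $q<p$ and, for the largest such $q$, either $\eta(q)<\eta'(q)$ and $\eta(q+1)=1$, or $\eta(q)>\eta'(q)$ and $\eta(q+1)=-1$; and $\eta\preceq_P\eta'$ if $\eta=\eta'$ or $\eta\prec_P\eta'$. A sign condition $\eta$ on $\mathrm{Der}(P)$ is extended to $\eta_+$ on $\mathrm{Der}_+(P)$ by $\eta_+(P)=0$; its multiplicity $\mathrm{mu}(\eta,P)$ is the smallest $i\in\{0,\dots,p\}$ with $\eta_+(i)\ne0$; and $\eta\prec_P^{\mathrm{mu}}\eta'$ means that $\mathrm{mu}(\eta,P)>\mathrm{mu}(\eta',P)$, or these are equal and $\eta_+\prec_P\eta'_+$. For a list of sign conditions on $\mathrm{Der}(P)$, $\mathrm{vmu}$ is the list of their multiplicities in non-increasing order. $\mathrm H(\mathcal Q)$ is the set of lists $\boldsymbol\eta=[\eta_1,\dots,\eta_r]$ of distinct sign conditions on $\mathrm{Der}_+(\mathcal Q)$ such that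 (restricting to $\mathrm{Der}_+(P)$ where needed): for every $j$ there is $P\in\mathcal Q$ with $\eta_j(P)=0$; for every $j$ and every $P\in\mathcal Q$ with $\eta_j(P)=0$, $\eta_{j'}\prec_P\eta_j$ for $j'<j$ and $\eta_j\prec_P\eta_{j'}$ for $j'>j$; and $\eta_j\preceq_P\eta_{j'}$ for all $j<j'$ and $P\in\mathcal Q$. For such $\boldsymbol\eta$ and $P\in\mathcal Q$, $\boldsymbol\eta(P)$ is the list of the restrictions to $\mathrm{Der}(P)$ of those $\eta_j$ with $\eta_j(P)=0$. $\Lambda_n$ is the set of non-increasing vectors of positive integers with sum $n$ (it is empty if $n\notin\mathbb N$), $\#\nu$ denotes the length and $|\nu|$ the sum of a vector $\nu$, and $\mathrm N(\mathcal Q,\boldsymbol\eta)=\prod_{P\in\mathcal Q}\Lambda_{\frac12(\deg_yP-|\mathrm{vmu}(\boldsymbol\eta(P))|)}$. *Factorization systems.* For monic $P\in\mathbf R[y]$, vectors $\mu,\nu$ of positive integers, $t\in\mathbf R^{\#\mu}$ and $z=a+ib$ with $a,b\in\mathbf R^{\#\nu}$, $\mathrm{Fact}(P)^{\mu,\nu}(t,z)$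 says that $$P=\prod_j(y-t_j)^{\mu_j}\prod_k\big((y-a_k)^2+b_k^2\big)^{\nu_k},$$ the $t_j$ are pairwise distinct, all $b_k\ne0$, and for $k<k'$ the resultant $\big((a_k-a_{k'})^2+(b_k-b_{k'})^2\big)\big((a_k-a_{k'})^2+(b_k+b_{k'})^2\big)$ of $(y-a_k)^2+b_k^2$ and $(y-a_{k'})^2+b_{k'}^2$ is non-zero. For $\upsilon\in\mathbf R^k$, $\boldsymbol\eta\in\mathrm H(\mathcal Q)$ of length $r$ and $\boldsymbol\nu\in\mathrm N(\mathcal Q,\boldsymbol\eta)$, $t\in\mathbf R^r$ and $z=(z_P)_{P\in\mathcal Q}$ with $z_P=a_P+ib_P$, $a_P,b_P\in\mathbf R^{\#\boldsymbol\nu(P)}$, the system $\mathrm{OFact}(\mathcal Q(\upsilon))^{\boldsymbol\eta,\boldsymbol\nu}(t,z)$ says that $$\mathrm{Fact}(P(\upsilon,y))^{\mathrm{vmu}(\boldsymbol\eta(P)),\boldsymbol\nu(P)}(t_P,z_P)\ \text{ for all }P\in\mathcal Q,\qquad t_1<\dots<t_r,$$ where $t_P$ is the vector of those $t_j$ with $\eta_j(P)=0$,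 listed in the order $\prec_P^{\mathrm{mu}}$ of the restrictions of the $\eta_j$ to $\mathrm{Der}(P)$. *Statement.* For every realizable sign condition $\tau$ on $\mathrm{Elim}(\mathcal Q)$ there exist $\boldsymbol\eta(\tau)\in\mathrm H(\mathcal Q)$ and $\boldsymbol\nu(\tau)\in\mathrm N(\mathcal Q,\boldsymbol\eta(\tau))$ such that for every $\upsilon\in\mathrm{Real}(\tau,\mathbf R)$ there exist $\theta\in\mathbf R^{\#\boldsymbol\eta(\tau)}$ and $\alpha,\beta\in\mathbf R^{s}$, $s=\sum_{P\in\mathcal Q}\#\boldsymbol\nu(\tau)(P)$, such that $$\mathrm{OFact}(\mathcal Q(\upsilon))^{\boldsymbol\eta(\tau),\boldsymbol\nu(\tau)}(\theta,\alpha+i\beta).$$ -/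

import Mathlib

open Polynomial

namespace RootOrder

noncomputable section

/-! ### Sign conditions -/

/-- A sign condition on a set `S` of polynomials, i.e. an element of `{-1, 0, 1}^S`. -/
abbrev SignCond {A : Type*} (S : Set A) : Type _ := S → SignType

/-- The restriction of a sign condition to a subset. -/
def SignCond.restrict {A : Type*} {S T : Set A} (h : T ⊆ S) (η : SignCond S) : SignCond T :=
  fun x => η ⟨x.1, h x.2⟩

/-- The realization in `R^k` of a sign condition on a set of polynomials in `K[u₁, …, u_k]`. -/
def realization {K : Type*} [Field K] (R : Type*) [Field R] [LinearOrder R] [Algebra K R] {k : ℕ}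
    {S : Set (MvPolynomial (Fin k) K)} (τ : SignCond S) : Set (Fin k → R) :=
  {υ | ∀ f : S, SignType.sign (MvPolynomial.aeval υ f.1) = τ f}

section Families

variable {A : Type*} [CommRing A]

/-! ### Derivatives -/

/-- `Der(P)`: the first `p - 1` derivatives `P', …, P^(p-1)` of `P`, where `p = deg P`. -/
def der (P : A[X]) : Set A[X] :=
  {f | ∃ h, 1 ≤ h ∧ h < P.natDegree ∧ f = derivative^[h] P}

/-- `Der₊(P)`: the polynomial `P` together with `Der(P)`. -/
def derPlus (P : A[X]) : Set A[X] := insert P (der P)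

/-- `Der₊(𝒬)`: the union of the sets `Der₊(P)` for `P ∈ 𝒬`. -/
def derPlusFamily (Q : Finset A[X]) : Set A[X] := {f | ∃ P ∈ Q, f ∈ derPlus P}

theorem der_subset_derPlus (P : A[X]) : der P ⊆ derPlus P := Set.subset_insert _ _

theorem self_mem_derPlus (P : A[X]) : P ∈ derPlus P := Set.mem_insert _ _

theorem derPlus_subset_family {Q : Finset A[X]} {P : A[X]} (hP : P ∈ Q) :
    derPlus P ⊆ derPlusFamily Q := fun _ hf => ⟨P, hP, hf⟩

theorem iterate_derivative_mem_derPlus {P : A[X]} {h : ℕ} (hh : h < P.natDegree) :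
    derivative^[h] P ∈ derPlus P := by
  rcases Nat.eq_zero_or_pos h with rfl | h0
  · exact self_mem_derPlus P
  · exact der_subset_derPlus P ⟨h, h0, hh, rfl⟩

/-! ### Thom encodings, their order and multiplicities

All polynomials below are monic, so the sign `η(p)` of the leading coefficient is `1`. -/

/-- The sign `η(k)` that a sign condition on `Der₊(P)` prescribes for `P^(k)`, `0 ≤ k < p`,
extended by `η(p) = sign of the leading coefficient = 1` for monic `P` of degree `p`. -/
def signAt (P : A[X]) (η : SignCond (derPlus P)) (k : ℕ) : SignType :=
  if h : k < P.natDegree then η ⟨derivative^[k] P, iterate_derivative_mem_derPlus h⟩ else 1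

open Classical in
/-- `η₊`: the extension by `η₊(0) = 0` of a sign condition on `Der(P)` to `Der₊(P)`. -/
def extendZero (P : A[X]) (η : SignCond (der P)) : SignCond (derPlus P) :=
  fun f => if h : f.1 ∈ der P then η ⟨f.1, h⟩ else 0

/-- The order `η₁ ≺_P η₂` on sign conditions on `Der₊(P)`: here `q` is the biggest index at which
the two differ. -/
def ThomLT (P : A[X]) (η₁ η₂ : SignCond (derPlus P)) : Prop :=
  ∃ q < P.natDegree, signAt P η₁ q ≠ signAt P η₂ q ∧
    (∀ k, q < k → k < P.natDegree → signAt P η₁ k = signAt P η₂ k) ∧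
    ((signAt P η₁ q < signAt P η₂ q ∧ signAt P η₁ (q + 1) = 1) ∨
      (signAt P η₁ q > signAt P η₂ q ∧ signAt P η₁ (q + 1) = -1))

/-- `η₁ ⪯_P η₂`. -/
def ThomLE (P : A[X]) (η₁ η₂ : SignCond (derPlus P)) : Prop := η₁ = η₂ ∨ ThomLT P η₁ η₂

/-- The multiplicity `mu(η, P)` of a sign condition on `Der(P)`: the smallest `i`, `0 ≤ i ≤ p`,
with `η₊(i) ≠ 0`. -/
def mult (P : A[X]) (η : SignCond (der P)) : ℕ :=
  sInf {i | i ≤ P.natDegree ∧ signAt P (extendZero P η) i ≠ 0}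

/-- The order `η₁ ≺_P^mu η₂` on sign conditions on `Der(P)`: decreasing multiplicity first. -/
def MultThomLT (P : A[X]) (η₁ η₂ : SignCond (der P)) : Prop :=
  mult P η₂ < mult P η₁ ∨
    (mult P η₁ = mult P η₂ ∧ ThomLT P (extendZero P η₁) (extendZero P η₂))

/-- The vector of multiplicities `vmu` of a list of sign conditions on `Der(P)`: the list of their
multiplicities, in non-increasing order. -/
def vmu (P : A[X]) (η : List (SignCond (der P))) : List ℕ :=
  (η.map (mult P)).insertionSort (· ≥ ·)

/-! ### The eliminating family -/

/-- The Hermite matrix `Her(P; Q)`, for `P` monic of degree `p`: the `p × p` matrix whose `(i, j)`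
entry (indices starting at `0`) is the trace of the multiplication by `Q * y^(i + j)` on
`A[y] / (P)`. -/
def hermite (P Q : A[X]) : Matrix (Fin P.natDegree) (Fin P.natDegree) A :=
  Matrix.of fun i j =>
    Algebra.trace A (AdjoinRoot P) (AdjoinRoot.mk P (Q * X ^ ((i : ℕ) + (j : ℕ))))

/-- `HMi(P; Q)`: the (leading) principal minors of sizes `1, …, p` of the Hermite matrix. -/
def hermiteMinors (P Q : A[X]) : Set A :=
  {f | ∃ (j : ℕ) (_ : 1 ≤ j) (hj : j ≤ P.natDegree),
    f = ((hermite P Q).submatrix (Fin.castLE hj) (Fin.castLE hj)).det}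

/-- `PDer_i(P)`: the products `∏_{1 ≤ h ≤ p - 1} (P^(h))^(α_h)` with `α_h ∈ {0, 1, 2}` and at most
`i` nonzero exponents. -/
def pder (i : ℕ) (P : A[X]) : Set A[X] :=
  {f | ∃ α : ℕ → ℕ, (∀ h, α h ≤ 2) ∧
    ((Finset.Icc 1 (P.natDegree - 1)).filter fun h => α h ≠ 0).card ≤ i ∧
    f = ∏ h ∈ Finset.Icc 1 (P.natDegree - 1), (derivative^[h] P) ^ α h}

/-- `PDer_i(P; Q)`: the products `A * B` with `A ∈ PDer_i(P)` and `B ∈ {Q, Q²}`. -/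
def pderWith (i : ℕ) (P Q : A[X]) : Set A[X] :=
  {f | ∃ a ∈ pder i P, ∃ b ∈ ({Q, Q ^ 2} : Set A[X]), f = a * b}

/-- `ThElim(P)`; `Nat.size p` is the number of binary digits of `p = deg P`. -/
def thElim (P : A[X]) : Set A :=
  {f | ∃ a ∈ pder (Nat.size P.natDegree) P, f ∈ hermiteMinors P a}

/-- `ThElim(P; Q)`. -/
def thElimWith (P Q : A[X]) : Set A :=
  {f | ∃ a ∈ pderWith (Nat.size P.natDegree - 1) P Q, f ∈ hermiteMinors P a}

/-- `Elim(𝒬)`. -/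
def elimFamily (Q : Finset A[X]) : Set A :=
  {f | ∃ P ∈ Q, f ∈ thElim P} ∪
    {f | ∃ P ∈ Q, ∃ q ∈ derPlusFamily Q \ derPlus P, f ∈ thElimWith P q}

/-! ### Combinatorial descriptions of the roots of a family -/

/-- The restriction to `Der₊(P)` of a sign condition on `Der₊(𝒬)`, for `P ∈ 𝒬`. -/
def onDerPlus {Q : Finset A[X]} (η : SignCond (derPlusFamily Q)) (P : Q) :
    SignCond (derPlus P.1) :=
  η.restrict (derPlus_subset_family P.2)

/-- The restriction to `Der(P)` of a sign condition on `Der₊(𝒬)`, for `P ∈ 𝒬`. -/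
def onDer {Q : Finset A[X]} (η : SignCond (derPlusFamily Q)) (P : Q) : SignCond (der P.1) :=
  (onDerPlus η P).restrict (der_subset_derPlus P.1)

/-- The sign `η(P)`, for `P ∈ 𝒬`. -/
def signOf {Q : Finset A[X]} (η : SignCond (derPlusFamily Q)) (P : Q) : SignType :=
  η ⟨P.1, derPlus_subset_family P.2 (self_mem_derPlus P.1)⟩

/-- `H(𝒬)`: the possible descriptions of the total ordered list of real roots of the family. -/
def rootLists (Q : Finset A[X]) : Set (List (SignCond (derPlusFamily Q))) :=
  {η | η.Nodup ∧
    (∀ j : Fin η.length, ∃ P : Q, signOf (η.get j) P = 0) ∧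
    (∀ (j : Fin η.length) (P : Q), signOf (η.get j) P = 0 →
      (∀ j' < j, ThomLT P.1 (onDerPlus (η.get j') P) (onDerPlus (η.get j) P)) ∧
      (∀ j' > j, ThomLT P.1 (onDerPlus (η.get j) P) (onDerPlus (η.get j') P))) ∧
    (∀ (j j' : Fin η.length), j < j' → ∀ P : Q,
      ThomLE P.1 (onDerPlus (η.get j) P) (onDerPlus (η.get j') P))}

/-- The increasing list of the indices `j` with `η_j(P) = 0`. -/
def rootIndices {Q : Finset A[X]} (η : List (SignCond (derPlusFamily Q))) (P : Q) :
    List (Fin η.length) :=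
  (List.finRange η.length).filter fun j => signOf (η.get j) P = 0

/-- `𝛈(P)`: the ordered list of the restrictions to `Der(P)` of those `η_j` with `η_j(P) = 0`. -/
def rootsOf {Q : Finset A[X]} (η : List (SignCond (derPlusFamily Q))) (P : Q) :
    List (SignCond (der P.1)) :=
  (rootIndices η P).map fun j => onDer (η.get j) P

open Classical in
/-- The indices `j` with `η_j(P) = 0`, listed in the order `≺_P^mu` of the sign conditions. -/
def sortedIndices {Q : Finset A[X]} (η : List (SignCond (derPlusFamily Q))) (P : Q) :
    List (Fin η.length) :=
  (rootIndices η P).insertionSort fun j j' =>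
    MultThomLT P.1 (onDer (η.get j) P) (onDer (η.get j') P)

theorem length_vmu_rootsOf {Q : Finset A[X]} (η : List (SignCond (derPlusFamily Q))) (P : Q) :
    (vmu P.1 (rootsOf η P)).length = (sortedIndices η P).length := by
  simp [vmu, rootsOf, sortedIndices]

/-- `Λ_n`: the vectors of positive integers in non-increasing order whose sum is `n`. -/
def partitions (n : ℕ) : Set (List ℕ) :=
  {μ | μ.Pairwise (· ≥ ·) ∧ (∀ m ∈ μ, 0 < m) ∧ μ.sum = n}

/-- `N(𝒬, 𝛈)`: the product over `P ∈ 𝒬` of the sets `Λ_n` with `n = (deg P - |vmu(𝛈(P))|) / 2`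
(empty if for some `P` this is not a natural number). -/
def complexMults (Q : Finset A[X]) (η : List (SignCond (derPlusFamily Q))) : Set (Q → List ℕ) :=
  {ν | ∀ P : Q, ∃ n : ℕ, (vmu P.1 (rootsOf η P)).sum + 2 * n = P.1.natDegree ∧
    ν P ∈ partitions n}

end Families

/-! ### Factorizations over a real closed field -/

section Factorizations

variable {R : Type*} [Field R]

/-- `R(z, z')` for `z = a + i b`, `z' = a' + i b'`: the resultant of `(y - a)² + b²` and
`(y - a')² + b'²`. -/
def resPair (a b a' b' : R) : R :=
  ((a - a') ^ 2 + (b - b') ^ 2) * ((a - a') ^ 2 + (b + b') ^ 2)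

/-- The system `Fact(P)^{μ,ν}(t, z)`, where `z_k = a_k + i b_k`: the decomposition of `P` into real
irreducible factors with multiplicities `μ` for the distinct real roots `t_j` and `ν` for the
distinct pairs of conjugate non-real roots `a_k ± i b_k`. -/
def FactSystem (P : R[X]) (μ ν : List ℕ) (t : Fin μ.length → R) (a b : Fin ν.length → R) : Prop :=
  P = (∏ j, (X - C (t j)) ^ μ.get j) *
      (∏ k, ((X - C (a k)) ^ 2 + C (b k) ^ 2) ^ ν.get k) ∧
    (∀ j j', j < j' → t j ≠ t j') ∧
    (∀ k, b k ≠ 0) ∧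
    (∀ k k', k < k' → resPair (a k) (b k) (a k') (b k') ≠ 0)

/-- The polynomial `P(υ, y)` obtained from `P(u, y)` by specializing the parameters. -/
def specializeAt {K : Type*} [Field K] [Algebra K R] {k : ℕ} (υ : Fin k → R)
    (P : (MvPolynomial (Fin k) K)[X]) : R[X] :=
  P.map (MvPolynomial.aeval υ : MvPolynomial (Fin k) K →ₐ[K] R).toRingHom

/-- The system `OFact(𝒬)^{𝛈,𝛎}(t, z)` at the parameter `υ`, where `z_P = a_P + i b_P`. The vector
`t_P` consists of the `t_j` with `η_j(P) = 0`, in the order `≺_P^mu`. -/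
def OFact [LinearOrder R] {K : Type*} [Field K] [Algebra K R] {k : ℕ}
    (Q : Finset (MvPolynomial (Fin k) K)[X])
    (η : List (SignCond (derPlusFamily Q))) (ν : Q → List ℕ) (υ : Fin k → R)
    (t : Fin η.length → R) (a b : (P : Q) → Fin (ν P).length → R) : Prop :=
  (∀ P : Q, FactSystem (specializeAt υ P.1) (vmu P.1 (rootsOf η P)) (ν P)
      (fun i => t ((sortedIndices η P).get (i.cast (length_vmu_rootsOf η P)))) (a P) (b P)) ∧
    ∀ j j', j < j' → t j < t j'

end Factorizations

end

end RootOrder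

open RootOrder

/-! Fix one parameter realizing `τ` and read off from it the increasing list of all real roots of
the family, with the signs of `Der₊(𝒬)` at each root, and the multiplicities of the pairs of
conjugate roots of each `P`. The theorem says that these data depend on `τ` only. It is proved by
comparing two specializations `φ`, `φ'` that give the same signs to the polynomials of `elimFamily
Q`.

The link between signs and roots is Hermite's form `g ↦ tr(A g²)` on `R[y]/(P)`. Its rank is the
number of distinct complex roots of `P` where `A ≠ 0`, and its signature is the Tarski query `∑ sign
A(x)` over the distinct real roots. The form is Hankel, so the signs of its leading principal minors
determine rank and signature even when some minors vanish (Frobenius). Here this takes a comparative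
form: `exists_hankelNonneg` produces semidefinite subspaces of the same dimensions for both
specializations, and `finrank_le_of_hankelNonneg` shows that these dimensions are as large as
possible.

Tarski queries of products of derivatives are moments of the distribution of sign patterns over the
roots. A distribution with fewer than `2 ^ (b + 1)` patterns is determined by the moments with at
most `b` nonzero exponents (`eq_zero_of_moments_eq_zero`); this is why the logarithmic bound in
`pder` suffices. Hence the number of real roots of `P` with a given derivative pattern is the same
for `φ` and `φ'`. By Thom's lemma this number is at most one, so roots can be matched, and the same
lemma shows that the patterns dictate their order. The signs of the other polynomials at a root
follow from the queries twisted by `Q` and `Q²` (`exists_signsAt_eq`, `Describes.transfer`).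

For non-real roots the ranks replace the signatures: they count complex roots by the vanishing
pattern of the derivatives, hence by multiplicity. Subtracting the real roots and halving gives the
multiplicities of the conjugate pairs (`card_upperRoots_cxMult_eq`). Since `R[i]` is algebraically
closed, these data yield the required factorizations. -/

namespace RootOrder

noncomputable section

/-! ### The algebraic closure of a real closed field -/

section RealClosed

variable {R : Type*} [Field R]

/-- The extension `R[i]` of a field `R`. -/
abbrev Cx (R : Type*) [Field R] : Type _ := QuadraticAlgebra R (-1) 0

/-- A quadratic polynomial over a field in which every element is a square has a root. -/
theorem exists_isRoot_of_natDegree_eq_two {F : Type*} [Field F] [NeZero (2 : F)]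
    (hF : ∀ x : F, IsSquare x) {p : F[X]} (hp : p.natDegree = 2) : ∃ x, p.IsRoot x := by
  have ha : p.coeff 2 ≠ 0 := by
    rw [← hp]; exact leadingCoeff_ne_zero.2 (by rintro rfl; simp at hp)
  obtain ⟨s, hs⟩ := hF (discrim (p.coeff 2) (p.coeff 1) (p.coeff 0))
  obtain ⟨x, hx⟩ := exists_quadratic_eq_zero ha ⟨s, hs⟩
  refine ⟨x, ?_⟩
  rw [IsRoot, eval_eq_sum_range, hp, ← hx]
  simp [Finset.sum_range_succ]; ring

/-- A finite separable extension whose degree forces its primitive elements to have a rational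
conjugate is trivial. -/
theorem finrank_eq_one_of_forall_exists_isRoot {F E : Type*} [Field F] [Field E] [Algebra F E]
    [FiniteDimensional F E] [Algebra.IsSeparable F E]
    (h : ∀ p : F[X], p.natDegree = Module.finrank F E → ∃ x, p.IsRoot x) :
    Module.finrank F E = 1 := by
  obtain ⟨α, hα⟩ := Field.exists_primitive_element F E
  have hd := (Field.primitive_element_iff_minpoly_natDegree_eq F α).1 hα
  obtain ⟨x, hx⟩ := h _ hd
  have h1 := degree_eq_one_of_irreducible_of_root
    (minpoly.irreducible (Algebra.IsIntegral.isIntegral (R := F) α)) hx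
  rw [← hd]
  exact natDegree_eq_of_degree_eq_some h1

variable [LinearOrder R] [IsStrictOrderedRing R]

-- Since `-1` is not a square in an ordered field, `Cx R` is a field.
instance : Fact (∀ r : R, r ^ 2 ≠ -1 + 0 * r) := ⟨fun r h => by nlinarith [sq_nonneg r]⟩

/-- The remainder modulo the quadratic has real coefficients, degree at most one, and vanishes at
the non-real `z`: the imaginary part kills its linear coefficient, then the real part its constant
one. -/
theorem quadratic_dvd_of_aeval_eq_zero {f : R[X]} {z : Cx R} (hz : aeval z f = 0)
    (him : z.im ≠ 0) : (X - C z.re) ^ 2 + C z.im ^ 2 ∣ f := by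
  have hq : ((X - C z.re) ^ 2 + C z.im ^ 2 : R[X]).Monic := by
    monicity!
  have hd : ((X - C z.re) ^ 2 + C z.im ^ 2 : R[X]).natDegree = 2 := by
    compute_degree!
  have hr : f %ₘ ((X - C z.re) ^ 2 + C z.im ^ 2) = 0 := by
    set r := f %ₘ ((X - C z.re) ^ 2 + C z.im ^ 2) with hrdef
    have h1 : aeval z r = 0 := by
      have h2 : aeval z ((X - C z.re) ^ 2 + C z.im ^ 2 : R[X]) = 0 := by
        simp only [map_add, map_pow, map_sub, aeval_X, aeval_C]
        ext <;> simp [pow_two]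
      have h3 := congrArg (aeval z) (modByMonic_add_div f ((X - C z.re) ^ 2 + C z.im ^ 2))
      rw [map_add, map_mul, h2, zero_mul, add_zero, hz] at h3
      exact h3
    have h4 : r.natDegree < 2 := by
      rw [← hd]
      exact natDegree_modByMonic_lt _ hq (by intro h; simp [h] at hd)
    have h5 : r = C (r.coeff 1) * X + C (r.coeff 0) :=
      eq_X_add_C_of_natDegree_le_one (by omega)
    rw [h5] at h1 ⊢
    simp only [map_add, map_mul, aeval_X, aeval_C] at h1
    have h6 := congrArg QuadraticAlgebra.im h1
    simp [him] at h6
    have h7 := congrArg QuadraticAlgebra.re h1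
    simp [h6] at h7
    simp [h6, h7]
  exact (modByMonic_eq_zero_iff_dvd hq).1 hr

variable [IsRealClosed R]

theorem exists_nonneg_sq_eq {x : R} (hx : 0 ≤ x) : ∃ r, 0 ≤ r ∧ r ^ 2 = x := by
  obtain ⟨r, hr⟩ := IsRealClosed.exists_eq_pow_of_nonneg hx two_ne_zero
  exact ⟨|r|, abs_nonneg r, by rw [sq_abs, hr]⟩

/-- Half-angle formulas: with `n` the modulus of `x + iy`, the root is `u ± iv` where `u² = (n +
x)/2` and `v² = (n - x)/2`. Then `2uv = ±y`, which decides the sign. -/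
theorem Cx.isSquare (z : Cx R) : IsSquare z := by
  obtain ⟨x, y⟩ := z
  obtain ⟨n, hn, hxy⟩ := exists_nonneg_sq_eq (add_nonneg (sq_nonneg x) (sq_nonneg y))
  have h1 : |x| ≤ n := abs_le_of_sq_le_sq (by nlinarith [sq_nonneg y]) hn
  obtain ⟨h2, h3⟩ := abs_le.1 h1
  obtain ⟨u, hu, hu2⟩ := exists_nonneg_sq_eq (x := (n + x) / 2) (by linarith)
  obtain ⟨v, hv, hv2⟩ := exists_nonneg_sq_eq (x := (n - x) / 2) (by linarith)
  have h4 : (2 * (u * v)) ^ 2 = y ^ 2 := by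
    calc (2 * (u * v)) ^ 2 = 4 * (u ^ 2 * v ^ 2) := by ring
      _ = y ^ 2 := by rw [hu2, hv2]; linear_combination hxy
  rcases sq_eq_sq_iff_eq_or_eq_neg.1 h4 with h | h
  · refine ⟨⟨u, v⟩, ?_⟩
    ext
    · simp; linear_combination hv2 - hu2
    · simp; linear_combination -h
  · refine ⟨⟨u, -v⟩, ?_⟩
    ext
    · simp; linear_combination hv2 - hu2
    · simp; linear_combination h

/-- The fixed field of a Sylow 2-subgroup has odd degree over `R`. Odd-degree polynomials have roots
in `R`, so this degree is one and the whole Galois group is a 2-group. -/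
theorem exists_natCard_gal_eq_two_pow (L : Type*) [Field L] [Algebra R L]
    [FiniteDimensional R L] [IsGalois R L] : ∃ n, Module.finrank R L = 2 ^ n := by
  have : Fact (Nat.Prime 2) := ⟨Nat.prime_two⟩
  obtain ⟨P⟩ : Nonempty (Sylow 2 (L ≃ₐ[R] L)) := inferInstance
  let F := IntermediateField.fixedField (P : Subgroup (L ≃ₐ[R] L))
  have h1 : Module.finrank F L = Nat.card P := IntermediateField.finrank_fixedField_eq_card _
  have h2 : Module.finrank R F * Module.finrank F L = Module.finrank R L :=
    Module.finrank_mul_finrank R F L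
  have h3 : Nat.card P * (P : Subgroup (L ≃ₐ[R] L)).index = Nat.card (L ≃ₐ[R] L) :=
    Subgroup.card_mul_index _
  rw [IsGalois.card_aut_eq_finrank, ← h2, h1, mul_comm] at h3
  have h4 := Nat.eq_of_mul_eq_mul_right Nat.card_pos h3
  have h5 : Odd (Module.finrank R F) := by
    rw [← Nat.not_even_iff_odd, even_iff_two_dvd, ← h4]
    exact P.not_dvd_index
  have h6 : Module.finrank R F = 1 := finrank_eq_one_of_forall_exists_isRoot fun p hp =>
    IsRealClosed.exists_isRoot_of_odd_natDegree (hp ▸ h5)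
  rw [h6, one_mul, h1] at h2
  exact ⟨_, h2.symm.trans P.card_eq_multiplicity⟩

/-- The Galois group over `Cx R` is a 2-group. If it were nontrivial, a subgroup of index two would
give a quadratic extension of `Cx R`, impossible because every element there is a square. -/
theorem Cx.finrank_eq_one (L : Type*) [Field L] [Algebra R L] [Algebra (Cx R) L]
    [IsScalarTower R (Cx R) L] [FiniteDimensional R L] [IsGalois R L] :
    Module.finrank (Cx R) L = 1 := by
  have : Fact (Nat.Prime 2) := ⟨Nat.prime_two⟩
  have : FiniteDimensional (Cx R) L := FiniteDimensional.right R (Cx R) L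
  have : IsGalois (Cx R) L := IsGalois.tower_top_of_isGalois R (Cx R) L
  obtain ⟨n, hn⟩ := exists_natCard_gal_eq_two_pow (R := R) L
  have h0 : Module.finrank R (Cx R) * Module.finrank (Cx R) L = Module.finrank R L :=
    Module.finrank_mul_finrank R (Cx R) L
  obtain ⟨m, -, hm⟩ := (Nat.dvd_prime_pow Nat.prime_two).1 (hn ▸ Dvd.intro_left _ h0)
  rcases m with _ | m
  · simpa using hm
  exfalso
  have hc := IsGalois.card_aut_eq_finrank (Cx R) L
  obtain ⟨H, hH⟩ := Sylow.exists_subgroup_card_pow_prime (G := L ≃ₐ[Cx R] L) 2 (n := m)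
    (by rw [hc, hm, pow_succ]; exact Dvd.intro _ rfl)
  let F := IntermediateField.fixedField H
  have h1 : Module.finrank F L = Nat.card H := IntermediateField.finrank_fixedField_eq_card _
  have h2 : Module.finrank (Cx R) F * Module.finrank F L = Module.finrank (Cx R) L :=
    Module.finrank_mul_finrank _ F L
  rw [h1, hH, hm, pow_succ, mul_comm] at h2
  have h3 : Module.finrank (Cx R) F = 2 := Nat.eq_of_mul_eq_mul_left (by positivity) h2
  have h4 : Module.finrank (Cx R) F = 1 := finrank_eq_one_of_forall_exists_isRoot fun p hp =>
    exists_isRoot_of_natDegree_eq_two Cx.isSquare (hp.trans h3)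
  omega

instance Cx.isAlgClosed : IsAlgClosed (Cx R) := by
  refine IsAlgClosed.of_exists_root _ fun p hm hp => ?_
  have : Fact (Irreducible p) := ⟨hp⟩
  have : FiniteDimensional (Cx R) (AdjoinRoot p) := (AdjoinRoot.powerBasis hp.ne_zero).finite
  have : FiniteDimensional R (AdjoinRoot p) := FiniteDimensional.trans R (Cx R) _
  let g := minpoly R (AdjoinRoot.root p)
  have hg : g.Monic := minpoly.monic (Algebra.IsIntegral.isIntegral _)
  have hpg : p ∣ g.map (algebraMap R (Cx R)) := by
    rw [← AdjoinRoot.mk_eq_zero, ← AdjoinRoot.aeval_eq, aeval_map_algebraMap]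
    exact minpoly.aeval _ _
  -- The factor `X ^ 2 + 1` puts a square root of `-1` into the splitting field, so that `Cx R`
  -- embeds in it.
  let f : R[X] := g * (X ^ 2 + 1)
  have hX : (X ^ 2 + 1 : R[X]).Monic := by monicity!
  have hf : f ≠ 0 := (hg.mul hX).ne_zero
  let L := SplittingField f
  have hs := SplittingField.splits f
  have : Normal R L := Normal.of_isSplittingField f
  have : IsGalois R L := ⟨⟩
  have hi : ∃ u : L, u * u = (-1 : R) • (1 : L) + (0 : R) • u := by
    have h1 : ((X ^ 2 + 1 : R[X]).map (algebraMap R L)).Splits :=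
      hs.of_dvd (map_ne_zero hf) (Polynomial.map_dvd _ (Dvd.intro_left _ rfl))
    obtain ⟨u, hu⟩ := h1.exists_eval_eq_zero (by
      rw [degree_map, degree_eq_natDegree hX.ne_zero,
        show (X ^ 2 + 1 : R[X]).natDegree = 2 by compute_degree!]
      simp)
    refine ⟨u, ?_⟩
    simp at hu ⊢
    linear_combination hu
  obtain ⟨u, hu⟩ := hi
  let j : Cx R →ₐ[R] L := QuadraticAlgebra.lift ⟨u, hu⟩
  let : Algebra (Cx R) L := j.toAlgebra
  have : IsScalarTower R (Cx R) L := IsScalarTower.of_algebraMap_eq fun x => (j.commutes x).symm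
  have h1 := Cx.finrank_eq_one (R := R) L
  have h2 : (p.map (algebraMap (Cx R) L)).Splits := by
    refine hs.of_dvd (map_ne_zero hf) ?_
    rw [IsScalarTower.algebraMap_eq R (Cx R) L, ← Polynomial.map_map]
    exact Polynomial.map_dvd _ (hpg.trans (Polynomial.map_dvd _ (Dvd.intro _ rfl)))
  obtain ⟨l, hl⟩ := h2.exists_eval_eq_zero (by rw [degree_map]; exact hp.degree_pos.ne')
  obtain ⟨x, rfl⟩ := (Algebra.finrank_eq_one_iff_bijective_algebraMap.1 h1).2 l
  refine ⟨x, ?_⟩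
  rw [eval_map_algebraMap, aeval_algebraMap_apply] at hl
  simpa using hl

/-- A nonconstant polynomial over a real closed field has a linear or a definite quadratic
factor. -/
theorem exists_linear_or_quadratic_factor {f : R[X]} (hf : f.natDegree ≠ 0) :
    (∃ t g, f = (X - C t) * g) ∨ ∃ a b g, b ≠ 0 ∧ f = ((X - C a) ^ 2 + C b ^ 2) * g := by
  obtain ⟨z, hz⟩ := IsAlgClosed.exists_aeval_eq_zero (Cx R) f
    (by contrapose! hf; exact natDegree_eq_of_degree_eq_some hf)
  by_cases him : z.im = 0
  · left
    have hz' : z = algebraMap R (Cx R) z.re := by ext <;> simp [him]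
    rw [hz', aeval_algebraMap_apply, FaithfulSMul.algebraMap_eq_zero_iff] at hz
    obtain ⟨g, hg⟩ := dvd_iff_isRoot.2 (show f.IsRoot z.re by simpa using hz)
    exact ⟨_, g, hg⟩
  · obtain ⟨g, hg⟩ := quadratic_dvd_of_aeval_eq_zero hz him
    exact Or.inr ⟨_, _, g, him, hg⟩

/-! ### Intermediate values, monotonicity and Thom's lemma over a real closed field. -/

/-- The intermediate value theorem for polynomials over a real closed field. -/
theorem exists_isRoot_of_eval_mul_eval_neg {f : R[X]} {a b : R} (hab : a < b)
    (h : f.eval a * f.eval b < 0) : ∃ c, a < c ∧ c < b ∧ f.eval c = 0 := by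
  -- Split off one factor at a time: a definite quadratic, or a linear factor whose root lies
  -- outside `(a, b)`, does not change sign between `a` and `b`, so the cofactor still does.
  induction hn : f.natDegree using Nat.strong_induction_on generalizing f with
  | _ n ih =>
    by_cases h0 : f.natDegree = 0
    · rw [eq_C_of_natDegree_eq_zero h0] at h
      simp at h
      exact absurd h (not_lt.2 (mul_self_nonneg _))
    have hf : f ≠ 0 := by rintro rfl; simp at h0
    rcases exists_linear_or_quadratic_factor h0 with ⟨t, g, hg⟩ | ⟨p, q, g, hq, hg⟩
    · by_cases ht : a < t ∧ t < b
      · exact ⟨t, ht.1, ht.2, by simp [hg]⟩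
      have hg0 : g ≠ 0 := by rintro rfl; simp [hg] at hf
      have hd : g.natDegree < n := by
        rw [← hn, hg, natDegree_mul (X_sub_C_ne_zero t) hg0, natDegree_X_sub_C]; omega
      have h1 : g.eval a * g.eval b < 0 := by
        have h2 : 0 ≤ (a - t) * (b - t) := by
          rcases lt_or_ge a t with h3 | h3
          · have : b ≤ t := not_lt.1 fun h => ht ⟨h3, h⟩
            exact mul_nonneg_of_nonpos_of_nonpos (by linarith) (by linarith)
          · exact mul_nonneg (by linarith) (by linarith)
        rw [hg] at h
        simp only [eval_mul, eval_sub, eval_X, eval_C] at h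
        by_contra! h4
        nlinarith [mul_nonneg h2 h4]
      obtain ⟨c, h2, h3, h4⟩ := ih _ hd h1 rfl
      exact ⟨c, h2, h3, by simp [hg, h4]⟩
    · have hg0 : g ≠ 0 := by rintro rfl; simp [hg] at hf
      have hqd : ((X - C p) ^ 2 + C q ^ 2 : R[X]).natDegree = 2 := by compute_degree!
      have hq0 : ((X - C p) ^ 2 + C q ^ 2 : R[X]) ≠ 0 := by
        intro h; simp [h] at hqd
      have hd : g.natDegree < n := by
        rw [← hn, hg, natDegree_mul hq0 hg0, hqd]; omega
      have h1 : g.eval a * g.eval b < 0 := by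
        rw [hg] at h
        simp only [eval_mul, eval_sub, eval_X, eval_C, eval_add, eval_pow] at h
        have h2 : 0 ≤ ((a - p) ^ 2 + q ^ 2) * ((b - p) ^ 2 + q ^ 2) := by positivity
        by_contra! h4
        nlinarith [mul_nonneg h2 h4]
      obtain ⟨c, h2, h3, h4⟩ := ih _ hd h1 rfl
      exact ⟨c, h2, h3, by simp [hg, h4]⟩

/-- Consider the slope `g = (f - f(a))/(X - a)`, for which `g(a) = f'(a) > 0`. If `f(b) ≤ f(a)`,
then `g` has a first root `c` in `(a, b]`, and `f'(c) = (c - a) g'(c)` forces `g'(c) > 0`. But `g >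
0` just before `c`, so intermediate values for `g/(X - c)` produce an earlier root of `g`. -/
theorem eval_lt_eval_of_derivative_pos {f : R[X]} {a b : R} (hab : a < b)
    (h : ∀ x, a ≤ x → x ≤ b → 0 < (derivative f).eval x) : f.eval a < f.eval b := by
  by_contra! hle
  obtain ⟨g, hg⟩ := dvd_iff_isRoot.2 (show (f - C (f.eval a)).IsRoot a by simp)
  have hf : f = (X - C a) * g + C (f.eval a) := by rw [← hg]; ring
  have hfx : ∀ x, f.eval x = (x - a) * g.eval x + f.eval a := fun x => by
    conv_lhs => rw [hf]
    simp
  have hd : derivative f = g + (X - C a) * derivative g := by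
    rw [hf]; simp [derivative_mul]
  have hga : 0 < g.eval a := by
    have := h a le_rfl hab.le
    rw [hd] at this; simpa using this
  have hgb : g.eval b ≤ 0 := by
    have := hfx b
    by_contra! hpos
    nlinarith [mul_pos (sub_pos.2 hab) hpos]
  have hg0 : g ≠ 0 := by rintro rfl; simp at hga
  classical
  let S := g.roots.toFinset.filter fun x => a < x ∧ x ≤ b
  have hS : S.Nonempty := by
    rcases hgb.lt_or_eq with h1 | h1
    · obtain ⟨c, h2, h3, h4⟩ := exists_isRoot_of_eval_mul_eval_neg hab
        (mul_neg_of_pos_of_neg hga h1)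
      exact ⟨c, by simp [S, hg0, h2, h3.le, h4]⟩
    · exact ⟨b, by simp [S, hg0, hab, h1]⟩
  obtain ⟨c, hcS, hmin⟩ := S.exists_min_image id hS
  simp only [S, Finset.mem_filter, Multiset.mem_toFinset, mem_roots hg0, IsRoot, id] at hcS hmin
  obtain ⟨hc, hac, hcb⟩ := hcS
  have hno : ∀ x, a < x → x < c → g.eval x ≠ 0 := fun x h1 h2 h3 =>
    absurd (hmin x ⟨h3, h1, h2.le.trans hcb⟩) (not_le.2 h2)
  obtain ⟨d, had, hdc⟩ := exists_between hac
  have hgd : 0 < g.eval d := by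
    by_contra! h1
    obtain ⟨x, h2, h3, h4⟩ := exists_isRoot_of_eval_mul_eval_neg had
      (mul_neg_of_pos_of_neg hga (h1.lt_of_ne (hno d had hdc)))
    exact hno x h2 (h3.trans hdc) h4
  obtain ⟨k, hk⟩ := dvd_iff_isRoot.2 (show g.IsRoot c from hc)
  have hkc : 0 < k.eval c := by
    have h1 := h c hac.le hcb
    rw [hd, hk] at h1
    simp [derivative_mul] at h1
    exact pos_of_mul_pos_right h1 (sub_nonneg.2 hac.le)
  have hkd : k.eval d < 0 := by
    rw [hk] at hgd
    simp at hgd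
    by_contra! h1
    nlinarith [mul_nonneg (sub_nonneg.2 hdc.le) h1]
  obtain ⟨x, h2, h3, h4⟩ := exists_isRoot_of_eval_mul_eval_neg hdc
    (mul_neg_of_neg_of_pos hkd hkc)
  exact hno x (had.trans h2) h3 (by rw [hk]; simp [h4])

/-- Thom's lemma: if all derivatives of `f` (including `f`) have the same sign at `a` and `b`, then
`f` has a constant nonzero sign between `a` and `b`. -/
theorem thom_sign_const {f : R[X]} (hf : f ≠ 0) {a b : R} (hab : a < b)
    (h : ∀ k, k < f.natDegree →
      SignType.sign ((derivative^[k] f).eval a) = SignType.sign ((derivative^[k] f).eval b)) :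
    f.eval a ≠ 0 ∧ ∀ x, a ≤ x → x ≤ b → SignType.sign (f.eval x) = SignType.sign (f.eval a) := by
  induction hn : f.natDegree generalizing f with
  | zero =>
    rw [eq_C_of_natDegree_eq_zero hn] at hf ⊢
    simp at hf
    simp [hf]
  | succ n ih =>
    -- By induction the derivative has a constant nonzero sign on `[a, b]`, so up to replacing `f`
    -- by `-f` the polynomial increases strictly. Equal signs at the two ends then force this sign
    -- throughout, and it cannot be zero.
    have key : ∀ g : R[X], (∀ x, a ≤ x → x ≤ b → 0 < (derivative g).eval x) →
        SignType.sign (g.eval a) = SignType.sign (g.eval b) →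
        g.eval a ≠ 0 ∧ ∀ x, a ≤ x → x ≤ b →
          SignType.sign (g.eval x) = SignType.sign (g.eval a) := by
      intro g hg hs
      have hlt := eval_lt_eval_of_derivative_pos hab hg
      refine ⟨fun h0 => ?_, fun x hax hxb => ?_⟩
      · rw [h0, sign_zero, eq_comm, sign_eq_zero_iff] at hs
        rw [h0, hs] at hlt; exact lt_irrefl _ hlt
      · have mono : ∀ x y, a ≤ x → x ≤ y → y ≤ b → g.eval x ≤ g.eval y := by
          intro x y h1 h2 h3
          rcases h2.eq_or_lt with rfl | h2
          · exact le_rfl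
          · exact (eval_lt_eval_of_derivative_pos h2 fun z hz hz' =>
              hg z (h1.trans hz) (hz'.trans h3)).le
        refine le_antisymm ?_ (SignType.sign.monotone (mono a x le_rfl hax hxb))
        rw [hs]
        exact SignType.sign.monotone (mono x b hax hxb le_rfl)
    have hd : (derivative f).natDegree = n := by
      rw [natDegree_derivative, hn]; rfl
    have hd0 : derivative f ≠ 0 := by
      intro h0
      have := derivative_eq_zero.1 h0
      omega
    obtain ⟨h1, h2⟩ := ih hd0 (fun k hk => by
      simpa only [Function.iterate_succ_apply] using h (k + 1) (by omega)) hd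
    have hs := h 0 (by omega)
    simp only [Function.iterate_zero, id] at hs
    rcases lt_or_gt_of_ne h1 with h3 | h3
    · obtain ⟨h4, h5⟩ := key (-f) (fun x hx hx' => by
        have := h2 x hx hx'
        rw [sign_neg h3, sign_eq_neg_one_iff] at this
        simpa using this) (by simp [Left.sign_neg, hs])
      refine ⟨by simpa using h4, fun x hx hx' => ?_⟩
      simpa [Left.sign_neg] using h5 x hx hx'
    · exact key f (fun x hx hx' => by
        have := h2 x hx hx'
        rwa [sign_pos h3, sign_eq_one_iff] at this) hs

/-- Thom's lemma for the derivative of order `q + 1` gives it a constant sign on `[x, y]`, and this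
sign is the direction in which the derivative of order `q` moves. This is the origin of the two
cases in `ThomLT`. -/
theorem thom_sign_lt {f : R[X]} (hf : f ≠ 0) {x y : R} (hxy : x < y) {q : ℕ}
    (hq : q < f.natDegree)
    (hne : SignType.sign ((derivative^[q] f).eval x) ≠ SignType.sign ((derivative^[q] f).eval y))
    (h : ∀ k, q < k → k < f.natDegree →
      SignType.sign ((derivative^[k] f).eval x) = SignType.sign ((derivative^[k] f).eval y)) :
    (SignType.sign ((derivative^[q] f).eval x) < SignType.sign ((derivative^[q] f).eval y) ∧
        SignType.sign ((derivative^[q + 1] f).eval x) = 1) ∨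
      (SignType.sign ((derivative^[q] f).eval y) < SignType.sign ((derivative^[q] f).eval x) ∧
        SignType.sign ((derivative^[q + 1] f).eval x) = -1) := by
  have hg0 : derivative^[q + 1] f ≠ 0 := by
    intro h0
    have h1 := congrArg (fun p => p.coeff (f.natDegree - (q + 1))) h0
    simp only [coeff_iterate_derivative, coeff_zero, nsmul_eq_mul, mul_eq_zero,
      Nat.cast_eq_zero, Nat.sub_add_cancel (show q + 1 ≤ f.natDegree from hq)] at h1
    rcases h1 with h1 | h1
    · rw [Nat.descFactorial_eq_zero_iff_lt] at h1; omega
    · exact hf (leadingCoeff_eq_zero.1 h1)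
  obtain ⟨h1, h2⟩ := thom_sign_const hg0 hxy (fun k hk => by
    rw [← Function.iterate_add_apply]
    have := natDegree_iterate_derivative f (q + 1)
    exact h _ (by omega) (by omega))
  rw [Function.iterate_succ_apply'] at h1 h2 ⊢
  rcases lt_or_gt_of_ne h1 with h3 | h3
  · right
    refine ⟨lt_of_le_of_ne (SignType.sign.monotone ?_) hne.symm, sign_neg h3⟩
    have := eval_lt_eval_of_derivative_pos (f := -(derivative^[q] f)) hxy fun z hz hz' => by
      have := h2 z hz hz'
      rw [sign_neg h3, sign_eq_neg_one_iff] at this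
      simpa using this
    simp at this
    exact this.le
  · left
    refine ⟨lt_of_le_of_ne (SignType.sign.monotone ?_) hne, sign_pos h3⟩
    exact (eval_lt_eval_of_derivative_pos hxy fun z hz hz' => by
      have := h2 z hz hz'
      rwa [sign_pos h3, sign_eq_one_iff] at this).le

end RealClosed

/-! ### Traces as sums over the roots -/

section Trace

/-- Both sides are multiplicative in `h`, and `h` splits. For a linear `h` the determinant is a
value of the characteristic polynomial, up to sign. -/
theorem det_aeval_eq_prod_roots_charpoly {n F : Type*} [Fintype n] [DecidableEq n] [Field F]
    [IsAlgClosed F] (N : Matrix n n F) (h : F[X]) :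
    (aeval N h).det = (N.charpoly.roots.map fun x => h.eval x).prod := by
  have hN := (IsAlgClosed.splits N.charpoly).eq_prod_roots_of_monic N.charpoly_monic
  have hcard : N.charpoly.roots.card = Fintype.card n := by
    rw [← (IsAlgClosed.splits N.charpoly).natDegree_eq_card_roots, N.charpoly_natDegree_eq_dim]
  have hlin : ∀ y : F, (aeval N (X - C y)).det =
      (N.charpoly.roots.map fun x => (X - C y : F[X]).eval x).prod := by
    intro y
    have h1 : aeval N (X - C y) = -(Matrix.scalar n y - N) := by
      simp [Algebra.algebraMap_eq_smul_one, Matrix.smul_one_eq_diagonal]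
    have h2 : N.charpoly.eval y = (N.charpoly.roots.map fun x => y - x).prod := by
      conv_lhs => rw [hN]
      rw [eval_multiset_prod, Multiset.map_map]
      simp
    rw [h1, Matrix.det_neg, ← Matrix.eval_charpoly, ← hcard, h2,
      ← Multiset.card_map (fun x => y - x) N.charpoly.roots, ← Multiset.prod_map_neg]
    simp
  have hmul : ∀ s : Multiset F, (aeval N (s.map fun y => X - C y).prod).det =
      (N.charpoly.roots.map fun x => ((s.map fun y => X - C y).prod : F[X]).eval x).prod := by
    intro s
    induction s using Multiset.induction with
    | empty => simp
    | cons y s ih =>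
      rw [Multiset.map_cons, Multiset.prod_cons, map_mul, Matrix.det_mul, ih, hlin,
        ← Multiset.prod_map_mul]
      simp only [eval_mul]
  conv_lhs => rw [(IsAlgClosed.splits h).eq_prod_roots]
  conv_rhs => rw [(IsAlgClosed.splits h).eq_prod_roots]
  rw [map_mul, Matrix.det_mul, hmul]
  simp only [eval_mul, Multiset.prod_map_mul, eval_C, Multiset.map_const', Multiset.prod_replicate,
    hcard, aeval_C, Algebra.algebraMap_eq_smul_one, Matrix.det_smul, Matrix.det_one, mul_one]

/-- The determinant formula applied to `C t - g` for each `t` identifies the characteristic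
polynomial of `g(N)`; its roots sum to the trace. -/
theorem trace_aeval_eq_sum_roots_charpoly {n F : Type*} [Fintype n] [DecidableEq n] [Field F]
    [IsAlgClosed F] (N : Matrix n n F) (g : F[X]) :
    (aeval N g).trace = (N.charpoly.roots.map fun x => g.eval x).sum := by
  have h : (aeval N g).charpoly =
      ((N.charpoly.roots.map fun x => g.eval x).map fun y => X - C y).prod := by
    refine Polynomial.funext fun t => ?_
    rw [Matrix.eval_charpoly, eval_multiset_prod]
    have h1 : Matrix.scalar n t - aeval N g = aeval N (C t - g) := by
      simp [Algebra.algebraMap_eq_smul_one, Matrix.smul_one_eq_diagonal]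
    rw [h1, det_aeval_eq_prod_roots_charpoly]
    simp
  rw [Matrix.trace_eq_sum_roots_charpoly, h, roots_multiset_prod_X_sub_C]

/-- By Cayley–Hamilton the characteristic polynomial kills the class of `y`, so `P` divides it; both
are monic of the same degree. -/
theorem charpoly_leftMulMatrix_powerBasis' {A : Type*} [CommRing A] [Nontrivial A] {P : A[X]}
    (hP : P.Monic) :
    (Algebra.leftMulMatrix (AdjoinRoot.powerBasis' hP).basis (AdjoinRoot.root P)).charpoly = P := by
  set b := (AdjoinRoot.powerBasis' hP).basis
  set M := Algebra.leftMulMatrix b (AdjoinRoot.root P)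
  have h1 : aeval (AdjoinRoot.root P) M.charpoly = 0 := by
    apply Algebra.leftMulMatrix_injective b
    rw [map_zero, ← aeval_algHom_apply]
    exact Matrix.aeval_self_charpoly M
  rw [AdjoinRoot.aeval_eq, AdjoinRoot.mk_eq_zero] at h1
  refine (eq_of_monic_of_dvd_of_natDegree_le hP M.charpoly_monic h1 ?_)
  rw [M.charpoly_natDegree_eq_dim]
  simp

/-- The trace of the multiplication by `g` on `A[y]/(P)`, specialized to an algebraically closed
field, is the sum of the values of `g` at the roots of `P`. -/
theorem map_trace_mk {A F : Type*} [CommRing A] [Field F] [IsAlgClosed F] (φ : A →+* F)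
    {P : A[X]} (hP : P.Monic) (g : A[X]) :
    φ (Algebra.trace A (AdjoinRoot P) (AdjoinRoot.mk P g)) =
      ((P.map φ).roots.map fun x => (g.map φ).eval x).sum := by
  have : Nontrivial A := φ.domain_nontrivial
  set b := (AdjoinRoot.powerBasis' hP).basis
  set M := Algebra.leftMulMatrix b (AdjoinRoot.root P) with hM
  have h1 : (M.map φ).charpoly = P.map φ := by
    rw [Matrix.charpoly_map, hM, charpoly_leftMulMatrix_powerBasis']
  rw [Algebra.trace_eq_matrix_trace b, ← AdjoinRoot.aeval_eq, ← aeval_algHom_apply, ← h1,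
    ← trace_aeval_eq_sum_roots_charpoly, AddMonoidHom.map_trace φ]
  congr 1
  have h2 : ∀ g : A[X], (aeval M g).map φ = aeval (M.map φ) (g.map φ) := by
    intro g
    induction g using Polynomial.induction_on' with
    | add p q hp hq => simp [Matrix.map_add, hp, hq]
    | monomial n a =>
      have h3 : (M ^ n).map φ = M.map φ ^ n := map_pow φ.mapMatrix M n
      ext i j
      simp [← C_mul_X_pow_eq_monomial, Algebra.algebraMap_eq_smul_one, ← h3]
  exact h2 g

end Trace

/-! ### Hankel forms -/

section Hankel

variable {F : Type*} [Field F]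

/-- The leading principal minor of size `n` of the Hankel form `(f, g) ↦ L (f g)`. -/
def hankelMinor (L : F[X] →ₗ[F] F) (n : ℕ) : F :=
  (Matrix.of fun i j : Fin n => L (X ^ ((i : ℕ) + (j : ℕ)))).det

theorem hankelMinor_zero (L : F[X] →ₗ[F] F) : hankelMinor L 0 = 1 := by simp [hankelMinor]

/-- `X ^ j` minus its projection on the polynomials of degree less than `j`; the projection exists
because the form is nondegenerate there. -/
theorem exists_monic_orthogonal {L : F[X] →ₗ[F] F} {j : ℕ} (h : hankelMinor L j ≠ 0) :
    ∃ q : F[X], q.Monic ∧ q.natDegree = j ∧ ∀ i < j, L (q * X ^ i) = 0 := by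
  set H : Matrix (Fin j) (Fin j) F := Matrix.of fun i k : Fin j => L (X ^ ((i : ℕ) + (k : ℕ)))
  let w : Fin j → F := fun i => L (X ^ (j + (i : ℕ)))
  let v := H⁻¹.mulVec w
  have hv : H.mulVec v = w := by
    simp only [v, Matrix.mulVec_mulVec]
    rw [Matrix.mul_nonsing_inv _ (isUnit_iff_ne_zero.2 h), Matrix.one_mulVec]
  have hdeg : (∑ k : Fin j, C (v k) * X ^ (k : ℕ)).degree < (j : WithBot ℕ) := by
    rw [← mem_degreeLT]
    exact Submodule.sum_mem _ fun k _ => mem_degreeLT.2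
      ((degree_C_mul_X_pow_le _ _).trans_lt (by exact_mod_cast k.2))
  refine ⟨X ^ j - ∑ k : Fin j, C (v k) * X ^ (k : ℕ), monic_X_pow_sub hdeg, ?_, fun i hi => ?_⟩
  · refine natDegree_eq_of_degree_eq_some ?_
    rw [degree_sub_eq_left_of_degree_lt (by rwa [degree_X_pow]), degree_X_pow]
  · have := congrFun hv ⟨i, hi⟩
    simp only [Matrix.mulVec, dotProduct, H, Matrix.of_apply, w] at this
    rw [sub_mul, Finset.sum_mul, map_sub, map_sum, ← pow_add, ← this, sub_eq_zero]
    refine Finset.sum_congr rfl fun k _ => ?_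
    rw [mul_assoc, ← pow_add, ← smul_eq_C_mul, map_smul, smul_eq_mul, mul_comm, add_comm i]

/-- The Gram determinant of a Hankel form does not change under a unitriangular change of basis. -/
theorem det_gram_eq_hankelMinor (L : F[X] →ₗ[F] F) {n : ℕ} (e : Fin n → F[X])
    (he : ∀ i, (e i).Monic) (hd : ∀ i, (e i).natDegree = i) :
    (Matrix.of fun i j => L (e i * e j)).det = hankelMinor L n := by
  let S : Matrix (Fin n) (Fin n) F := Matrix.of fun i d => (e i).coeff d
  have hS : S.det = 1 := by
    rw [Matrix.det_of_isLowerTriangular S (fun i d (hid : i < d) =>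
      coeff_eq_zero_of_natDegree_lt (by rw [hd]; exact hid))]
    refine Finset.prod_eq_one fun i _ => ?_
    have := he i
    rwa [Monic, leadingCoeff, hd] at this
  have hexp : ∀ i, e i = ∑ d : Fin n, C (S i d) * X ^ (d : ℕ) := fun i => by
    conv_lhs => rw [as_sum_range_C_mul_X_pow' (e i) (show (e i).natDegree < n by rw [hd]; exact i.2)]
    rw [Finset.sum_range]
    rfl
  have hmul : (Matrix.of fun i j => L (e i * e j)) =
      S * (Matrix.of fun i j : Fin n => L (X ^ ((i : ℕ) + (j : ℕ)))) * S.transpose := by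
    ext i j
    rw [Matrix.of_apply, hexp i, hexp j]
    simp only [Matrix.mul_apply, Matrix.of_apply, Matrix.transpose_apply, Finset.sum_mul,
      Finset.mul_sum, map_sum]
    refine Finset.sum_congr rfl fun c _ => Finset.sum_congr rfl fun d _ => ?_
    rw [mul_mul_mul_comm, ← C_mul, ← pow_add, ← smul_eq_C_mul, map_smul, smul_eq_mul]
    ring
  rw [hmul, Matrix.det_mul, Matrix.det_mul, Matrix.det_transpose, hS, hankelMinor]
  ring

theorem apply_mul_eq_coeff_mul {L : F[X] →ₗ[F] F} {q : F[X]} {m : ℕ}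
    (h : ∀ i < m, L (q * X ^ i) = 0) {s : F[X]} (hs : s.natDegree ≤ m) :
    L (q * s) = s.coeff m * L (q * X ^ m) := by
  conv_lhs => rw [as_sum_range_C_mul_X_pow' s (show s.natDegree < m + 1 by omega)]
  rw [Finset.sum_range_succ, mul_add, map_add, Finset.mul_sum, map_sum, Finset.sum_eq_zero]
  · rw [zero_add, mul_left_comm, ← smul_eq_C_mul, map_smul, smul_eq_mul]
  · intro i hi
    rw [mul_left_comm, ← smul_eq_C_mul, map_smul, h i (Finset.mem_range.1 hi), smul_zero]

/-- Compute the Gram determinant in the basis `1, …, X^(j-1), q, Xq, …, X^k q`, where `j = deg q`.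
Orthogonality makes it block diagonal. The block of the multiples of `q` vanishes above the
antidiagonal and is constant on it, so reversing its columns makes it triangular. -/
theorem hankelMinor_add {L : F[X] →ₗ[F] F} {q : F[X]} (hq : q.Monic) {k : ℕ}
    (h : ∀ i < q.natDegree + k, L (q * X ^ i) = 0) :
    hankelMinor L (q.natDegree + (k + 1)) = hankelMinor L q.natDegree *
      ((Equiv.Perm.sign (Fin.revPerm : Equiv.Perm (Fin (k + 1))) : ℤ) *
        L (q * X ^ (q.natDegree + k)) ^ (k + 1)) := by
  set j := q.natDegree with hj
  set a := L (q * X ^ (j + k))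
  let e : Fin (j + (k + 1)) → F[X] := fun d => if (d : ℕ) < j then X ^ (d : ℕ) else X ^ (d - j : ℕ) * q
  have he : ∀ d, (e d).Monic := fun d => by
    simp only [e]; split_ifs
    · exact monic_X_pow _
    · exact (monic_X_pow _).mul hq
  have hd : ∀ d, (e d).natDegree = d := fun d => by
    simp only [e]; split_ifs with h1
    · exact natDegree_X_pow _
    · rw [(monic_X_pow _).natDegree_mul hq, natDegree_X_pow]; omega
  let G : Matrix (Fin (k + 1)) (Fin (k + 1)) F :=
    Matrix.of fun i l => L (q * (X ^ ((i : ℕ) + (l : ℕ)) * q))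
  have hGdeg : ∀ i : ℕ, (X ^ i * q : F[X]).natDegree = i + j := fun i => by
    rw [(monic_X_pow _).natDegree_mul hq, natDegree_X_pow]
  have hG : (Equiv.Perm.sign (Fin.revPerm : Equiv.Perm (Fin (k + 1))) : ℤ) * G.det
      = a ^ (k + 1) := by
    rw [← Matrix.det_permute', Matrix.det_of_isLowerTriangular]
    · rw [Finset.prod_congr rfl (g := fun _ => a)]
      · simp
      · intro i _
        simp only [Matrix.submatrix_apply, id, G, Matrix.of_apply, Fin.revPerm_apply, Fin.val_rev]
        have h1 : (i : ℕ) + (k + 1 - (i + 1)) = k := by omega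
        rw [h1, apply_mul_eq_coeff_mul h (by rw [hGdeg, add_comm]), add_comm j k,
          ← hGdeg k, ((monic_X_pow k).mul hq).coeff_natDegree, hGdeg k, one_mul, add_comm k j]
    · intro i l (hil : i < l)
      simp only [Matrix.submatrix_apply, id, G, Matrix.of_apply, Fin.revPerm_apply, Fin.val_rev]
      rw [apply_mul_eq_coeff_mul h (by rw [hGdeg]; omega), coeff_eq_zero_of_natDegree_lt, zero_mul]
      rw [hGdeg]; omega
  have hblock : ((Matrix.of fun i l => L (e i * e l)).submatrix finSumFinEquiv finSumFinEquiv) =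
      Matrix.fromBlocks (Matrix.of fun i l : Fin j => L (X ^ ((i : ℕ) + (l : ℕ)))) 0 0 G := by
    ext (i | i) (l | l)
    · simp [e, pow_add]
    · simp only [Matrix.submatrix_apply, finSumFinEquiv_apply_left, finSumFinEquiv_apply_right, e,
        Matrix.of_apply, Fin.val_castAdd, Fin.is_lt, if_true, Fin.val_natAdd,
        Matrix.fromBlocks_apply₁₂, Matrix.zero_apply, add_lt_iff_neg_left, Nat.not_lt_zero,
        if_false, Nat.add_sub_cancel_left]
      rw [← mul_assoc, ← pow_add, mul_comm]
      exact h _ (by omega)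
    · simp only [Matrix.submatrix_apply, finSumFinEquiv_apply_left, finSumFinEquiv_apply_right, e,
        Matrix.of_apply, Fin.val_castAdd, Fin.is_lt, if_true, Fin.val_natAdd,
        Matrix.fromBlocks_apply₂₁, Matrix.zero_apply, add_lt_iff_neg_left, Nat.not_lt_zero,
        if_false, Nat.add_sub_cancel_left]
      rw [mul_right_comm, ← pow_add, mul_comm]
      exact h _ (by omega)
    · simp only [Matrix.submatrix_apply, finSumFinEquiv_apply_right, e,
        Matrix.of_apply, Fin.val_natAdd, Matrix.fromBlocks_apply₂₂, add_lt_iff_neg_left,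
        Nat.not_lt_zero, if_false, Nat.add_sub_cancel_left, G]
      congr 1
      ring
  rw [← det_gram_eq_hankelMinor L e he hd, ← Matrix.det_submatrix_equiv_self finSumFinEquiv,
    hblock, Matrix.det_fromBlocks_zero₂₁, ← hG, hankelMinor, ← mul_assoc _ _ G.det]
  congr 1
  rw [← Int.cast_mul, ← Units.val_mul, Int.units_mul_self]
  simp

/-- Each vanishing minor after a nonzero one extends the orthogonality of `q` by one power: by
`hankelMinor_add` the minor is, up to sign, a nonzero number times a power of the next value of `L`.
-/
theorem apply_mul_X_pow_eq_zero {L : F[X] →ₗ[F] F} {q : F[X]} (hq : q.Monic)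
    (h : ∀ i < q.natDegree, L (q * X ^ i) = 0) (h0 : hankelMinor L q.natDegree ≠ 0) {k : ℕ}
    (hk : ∀ i < k, hankelMinor L (q.natDegree + (i + 1)) = 0) :
    ∀ i < q.natDegree + k, L (q * X ^ i) = 0 := by
  induction k with
  | zero => simpa using h
  | succ k ih =>
    have ih' := ih fun i hi => hk i (by omega)
    have h1 := hankelMinor_add hq ih'
    rw [hk k (by omega), zero_eq_mul, or_iff_right h0, mul_eq_zero, or_iff_right] at h1
    · intro i hi
      rcases (show i < q.natDegree + k ∨ i = q.natDegree + k by omega) with h2 | rfl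
      · exact ih' i h2
      · exact pow_eq_zero_iff (by omega) |>.1 h1
    · rcases Int.units_eq_one_or (Equiv.Perm.sign (Fin.revPerm : Equiv.Perm (Fin (k + 1))))
        with h2 | h2 <;> simp [h2]

variable [LinearOrder F]

/-- The Hankel form of `L` on the polynomials of degree less than `j` is nonnegative on some
subspace of dimension `n`. -/
def HankelNonneg (L : F[X] →ₗ[F] F) (j n : ℕ) : Prop :=
  ∃ T : Submodule F F[X], T ≤ degreeLT F j ∧ Module.finrank F T = n ∧ ∀ f ∈ T, 0 ≤ L (f * f)

theorem HankelNonneg.zero (L : F[X] →ₗ[F] F) : HankelNonneg L 0 0 :=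
  ⟨⊥, bot_le, finrank_bot F _, fun f hf => by rw [Submodule.mem_bot] at hf; simp [hf]⟩

variable [IsStrictOrderedRing F]

/-- Add to the given subspace the multiples `q s` with `deg s < m`, which are orthogonal to it. On
them the form is `L (q · s²q)`. It vanishes when `2(m - 1) < k`, and when `2(m - 1) = k` it is the
square of the top coefficient of `s` times `L (q X^(j+k))`, where `j = deg q`. -/
theorem HankelNonneg.extend {L : F[X] →ₗ[F] F} {q : F[X]} (hq : q.Monic) {k n m : ℕ}
    (h : ∀ i < q.natDegree + k, L (q * X ^ i) = 0) (hn : HankelNonneg L q.natDegree n)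
    (hm : 2 * m ≤ k + 1 ∨ 2 * m = k + 2 ∧ 0 ≤ L (q * X ^ (q.natDegree + k))) :
    HankelNonneg L (q.natDegree + (k + 1)) (n + m) := by
  obtain ⟨T, hT, hTn, hTL⟩ := hn
  set j := q.natDegree with hj
  have hmul : Function.Injective (LinearMap.mulLeft F q) := fun a b hab =>
    mul_left_cancel₀ hq.ne_zero hab
  let U := (degreeLT F m).map (LinearMap.mulLeft F q)
  have hdT : ∀ f ∈ T, f = 0 ∨ f.natDegree < j := fun f hf => by
    by_cases hf0 : f = 0
    · exact Or.inl hf0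
    · exact Or.inr ((natDegree_lt_iff_degree_lt hf0).2 (mem_degreeLT.1 (hT hf)))
  have hdm : ∀ s ∈ degreeLT F m, s = 0 ∨ s.natDegree < m := fun f hf => by
    by_cases hf0 : f = 0
    · exact Or.inl hf0
    · exact Or.inr ((natDegree_lt_iff_degree_lt hf0).2 (mem_degreeLT.1 hf))
  have : FiniteDimensional F T := Submodule.finiteDimensional_of_le hT
  have hU : Module.finrank F U = m := by
    rw [← (Submodule.equivMapOfInjective _ hmul (degreeLT F m)).finrank_eq,
      (degreeLTEquiv F m).finrank_eq, Module.finrank_fin_fun]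
  have hdisj : T ⊓ U = ⊥ := by
    rw [eq_bot_iff]
    rintro f ⟨hf, s, hs, rfl⟩
    rw [Submodule.mem_bot]
    by_contra hne
    have hs0 : s ≠ 0 := by rintro rfl; simp at hne
    rcases hdT _ hf with h1 | h1
    · exact hne h1
    · rw [LinearMap.mulLeft_apply, natDegree_mul hq.ne_zero hs0] at h1; omega
  refine ⟨T ⊔ U, ?_, ?_, ?_⟩
  · refine sup_le (hT.trans (degreeLT_mono (by omega))) ?_
    rintro _ ⟨s, hs, rfl⟩
    rcases hdm s hs with rfl | h1
    · simp
    · rw [mem_degreeLT, LinearMap.mulLeft_apply]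
      refine (degree_le_natDegree).trans_lt ?_
      have := natDegree_mul_le (p := q) (q := s)
      exact_mod_cast show (q * s).natDegree < j + (k + 1) by omega
  · have h1 := Submodule.finrank_sup_add_finrank_inf_eq T U
    rw [hdisj, finrank_bot, hTn, hU] at h1
    simpa using h1
  · intro f hf
    obtain ⟨g, hg, _, ⟨s, hs, rfl⟩, rfl⟩ := Submodule.mem_sup.1 hf
    rw [LinearMap.mulLeft_apply]
    have hgd : g.natDegree + 1 ≤ j ∨ g = 0 := by
      rcases hdT g hg with h1 | h1
      · exact Or.inr h1
      · exact Or.inl h1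
    have h1 : L (q * (s * g)) = 0 := by
      rcases hdm s hs with rfl | h2
      · simp
      rcases hgd with h3 | rfl
      · have h4 := natDegree_mul_le (p := s) (q := g)
        rw [apply_mul_eq_coeff_mul h (by omega), coeff_eq_zero_of_natDegree_lt (by omega),
          zero_mul]
      · simp
    have h2 : 0 ≤ L (q * (s * s * q)) := by
      rcases hdm s hs with rfl | h2
      · simp
      have h4 := natDegree_mul_le (p := s) (q := s)
      have h5 := natDegree_mul_le (p := s * s) (q := q)
      rw [apply_mul_eq_coeff_mul h (by omega)]
      rcases hm with hm | ⟨hm, ha⟩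
      · rw [coeff_eq_zero_of_natDegree_lt (by omega), zero_mul]
      · refine mul_nonneg ?_ ha
        have h6 : (s * s * q).coeff ((m - 1 + (m - 1)) + j) = s.coeff (m - 1) * s.coeff (m - 1) := by
          rw [coeff_mul_add_eq_of_natDegree_le (by omega) (by omega), hj, hq.coeff_natDegree, mul_one,
            coeff_mul_add_eq_of_natDegree_le (by omega) (by omega)]
        rw [show j + k = (m - 1 + (m - 1)) + j by omega, h6]
        exact mul_self_nonneg _
    have h3 : (g + q * s) * (g + q * s) = g * g + (q * (s * g) + q * (s * g)) + q * (s * s * q) := by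
      ring
    rw [h3, map_add, map_add, map_add, h1]
    have := hTL g hg
    linarith

/-- An odd power keeps the sign of its base, so `hankelMinor_add` recovers the sign of the
antidiagonal entry from the minors. For even exponents this sign is lost, but it is not needed
there. -/
theorem sign_apply_eq_of_odd {L L' : F[X] →ₗ[F] F} {q q' : F[X]} (hq : q.Monic) (hq' : q'.Monic)
    (hd : q'.natDegree = q.natDegree) {k : ℕ} (hk : Odd (k + 1))
    (h : ∀ i < q.natDegree + k, L (q * X ^ i) = 0)
    (h' : ∀ i < q.natDegree + k, L' (q' * X ^ i) = 0)
    (h0 : hankelMinor L q.natDegree ≠ 0)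
    (hs : ∀ i ≤ q.natDegree + (k + 1),
      SignType.sign (hankelMinor L i) = SignType.sign (hankelMinor L' i)) :
    SignType.sign (L (q * X ^ (q.natDegree + k))) =
      SignType.sign (L' (q' * X ^ (q.natDegree + k))) := by
  have h1 := hankelMinor_add hq h
  have h2 := hankelMinor_add hq' (k := k) (by rwa [hd])
  rw [hd] at h2
  have h3 := hs _ le_rfl
  have h4 := hs q.natDegree (by omega)
  have hp : ∀ s : SignType, s ^ (k + 1) = s := fun s => by
    cases s
    · exact zero_pow (by omega)
    · exact hk.neg_one_pow
    · exact one_pow _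
  rw [h1, h2, sign_mul, sign_mul, sign_mul, sign_mul, sign_pow, sign_pow, hp, hp, h4] at h3
  rw [← sign_ne_zero, h4] at h0
  refine mul_left_cancel₀ ?_ (mul_left_cancel₀ h0 h3)
  rcases Int.units_eq_one_or (Equiv.Perm.sign (Fin.revPerm : Equiv.Perm (Fin (k + 1))))
    with h5 | h5 <;> simp [h5]

/-- Frobenius' rule, in comparative form: the signs of the leading principal minors of a
nondegenerate Hankel form determine the dimensions of suitable semidefinite subspaces. -/
theorem exists_hankelNonneg {L L' : F[X] →ₗ[F] F} {j : ℕ} (h0 : hankelMinor L j ≠ 0)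
    (hs : ∀ i ≤ j, SignType.sign (hankelMinor L i) = SignType.sign (hankelMinor L' i)) :
    ∃ n₁ n₂, n₁ + n₂ = j ∧ HankelNonneg L j n₁ ∧ HankelNonneg (-L) j n₂ ∧
      HankelNonneg L' j n₁ ∧ HankelNonneg (-L') j n₂ := by
  induction j using Nat.strong_induction_on with
  | _ j ih =>
    classical
    rcases Nat.eq_zero_or_pos j with rfl | hj
    · exact ⟨0, 0, rfl, .zero _, .zero _, .zero _, .zero _⟩
    -- Cut at the last nonzero minor before `j`. The signs agree, so the gap of length `k + 1` is
    -- the same for `L` and `L'`.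
    obtain ⟨i, hi, hmax⟩ := ((Finset.range j).filter fun i => hankelMinor L i ≠ 0).exists_max_image
      id ⟨0, by simp [hj, hankelMinor_zero]⟩
    simp only [Finset.mem_filter, Finset.mem_range, id] at hi hmax
    obtain ⟨hij, hi0⟩ := hi
    obtain ⟨k, rfl⟩ : ∃ k, j = i + (k + 1) := ⟨j - i - 1, by omega⟩
    have hzero : ∀ l < k, hankelMinor L (i + (l + 1)) = 0 := fun l hl => by
      by_contra hne
      have := hmax _ ⟨by omega, hne⟩
      omega
    have hne' : ∀ l ≤ i + (k + 1), hankelMinor L l ≠ 0 → hankelMinor L' l ≠ 0 := fun l hl h => by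
      rwa [← sign_ne_zero, ← hs l hl, sign_ne_zero]
    have hzero' : ∀ l < k, hankelMinor L' (i + (l + 1)) = 0 := fun l hl => by
      rw [← sign_eq_zero_iff, ← hs _ (by omega), hzero l hl, sign_zero]
    obtain ⟨n₁, n₂, hn, H1, H2, H3, H4⟩ := ih i hij hi0 fun l hl => hs l (by omega)
    obtain ⟨q, hq, hqd, hqo⟩ := exists_monic_orthogonal hi0
    obtain ⟨q', hq', hqd', hqo'⟩ := exists_monic_orthogonal (hne' i (by omega) hi0)
    have ho : ∀ l < q.natDegree + k, L (q * X ^ l) = 0 :=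
      apply_mul_X_pow_eq_zero hq (by rwa [hqd]) (by rwa [hqd]) (by rwa [hqd])
    have ho' : ∀ l < q'.natDegree + k, L' (q' * X ^ l) = 0 :=
      apply_mul_X_pow_eq_zero hq' (by rwa [hqd']) (by rw [hqd']; exact hne' i (by omega) hi0)
        (by rwa [hqd'])
    have hon : ∀ l < q.natDegree + k, (-L) (q * X ^ l) = 0 := fun l hl => by simp [ho l hl]
    have hon' : ∀ l < q'.natDegree + k, (-L') (q' * X ^ l) = 0 := fun l hl => by simp [ho' l hl]
    have key : ∀ m₁ m₂, m₁ + m₂ = k + 1 →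
        (2 * m₁ ≤ k + 1 ∨ 2 * m₁ = k + 2 ∧ 0 ≤ L (q * X ^ (q.natDegree + k))) →
        (2 * m₂ ≤ k + 1 ∨ 2 * m₂ = k + 2 ∧ 0 ≤ (-L) (q * X ^ (q.natDegree + k))) →
        (2 * m₁ ≤ k + 1 ∨ 2 * m₁ = k + 2 ∧ 0 ≤ L' (q' * X ^ (q'.natDegree + k))) →
        (2 * m₂ ≤ k + 1 ∨ 2 * m₂ = k + 2 ∧ 0 ≤ (-L') (q' * X ^ (q'.natDegree + k))) →
        ∃ n₁ n₂, n₁ + n₂ = i + (k + 1) ∧ HankelNonneg L (i + (k + 1)) n₁ ∧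
          HankelNonneg (-L) (i + (k + 1)) n₂ ∧ HankelNonneg L' (i + (k + 1)) n₁ ∧
          HankelNonneg (-L') (i + (k + 1)) n₂ := by
      intro m₁ m₂ hm c1 c2 c3 c4
      refine ⟨n₁ + m₁, n₂ + m₂, by omega, ?_, ?_, ?_, ?_⟩
      · have := HankelNonneg.extend hq ho (by rwa [hqd]) c1; rwa [hqd] at this
      · have := HankelNonneg.extend hq hon (by rwa [hqd]) c2; rwa [hqd] at this
      · have := HankelNonneg.extend hq' ho' (by rwa [hqd']) c3; rwa [hqd'] at this
      · have := HankelNonneg.extend hq' hon' (by rwa [hqd']) c4; rwa [hqd'] at this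
    -- An even gap contributes equally to both signs. For an odd gap the extra dimension goes to the
    -- sign of the antidiagonal entry, which `L` and `L'` share.
    rcases Nat.even_or_odd' (k + 1) with ⟨m, hm | hm⟩
    · exact key m m (by omega) (by omega) (by omega) (by omega) (by omega)
    · have hsgn := sign_apply_eq_of_odd hq hq' (by omega) (k := k) ⟨m, hm⟩ ho
        (by rw [hqd, ← hqd']; exact ho') (by rwa [hqd]) (by rwa [hqd])
      rw [show q.natDegree + k = q'.natDegree + k by omega] at hsgn key
      rcases le_total 0 (L (q * X ^ (q'.natDegree + k))) with h1 | h1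
      · have h2 : 0 ≤ L' (q' * X ^ (q'.natDegree + k)) := by
          rwa [← sign_nonneg_iff, ← hsgn, sign_nonneg_iff]
        exact key (m + 1) m (by omega) (Or.inr ⟨by omega, h1⟩) (by omega)
          (Or.inr ⟨by omega, h2⟩) (by omega)
      · have h2 : L' (q' * X ^ (q'.natDegree + k)) ≤ 0 := by
          rwa [← sign_nonpos_iff, ← hsgn, sign_nonpos_iff]
        exact key m (m + 1) (by omega) (by omega) (Or.inr ⟨by omega, by simpa using h1⟩)
          (by omega) (Or.inr ⟨by omega, by simpa using h2⟩)

end Hankel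

/-! ### Real roots and pairs of conjugate roots -/

section Roots

variable {R : Type*} [Field R] [LinearOrder R] [IsStrictOrderedRing R]

/-- The distinct roots of `f` in `R[i]`. -/
def cxRoots (f : R[X]) : Finset (Cx R) := (f.map (algebraMap R (Cx R))).roots.toFinset

/-- The distinct roots of `f` in the open upper half plane. -/
def upperRoots (f : R[X]) : Finset (Cx R) := (cxRoots f).filter fun z => 0 < z.im

/-- The multiplicity of `z` as a root of `f`. -/
def cxMult (f : R[X]) (z : Cx R) : ℕ := (f.map (algebraMap R (Cx R))).rootMultiplicity z

theorem mem_cxRoots {f : R[X]} (hf : f ≠ 0) {z : Cx R} : z ∈ cxRoots f ↔ aeval z f = 0 := by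
  rw [cxRoots, Multiset.mem_toFinset, mem_roots (map_ne_zero hf), IsRoot, eval_map_algebraMap]

theorem mem_upperRoots {f : R[X]} (hf : f ≠ 0) {z : Cx R} :
    z ∈ upperRoots f ↔ aeval z f = 0 ∧ 0 < z.im := by
  rw [upperRoots, Finset.mem_filter, mem_cxRoots hf]

theorem aeval_algebraMap_cx (x : R) (g : R[X]) :
    aeval (algebraMap R (Cx R) x) g = algebraMap R (Cx R) (g.eval x) := by
  rw [aeval_algebraMap_apply, coe_aeval_eq_eval]

omit [LinearOrder R] [IsStrictOrderedRing R] in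
theorem star_algebraMap_cx (x : R) : star (algebraMap R (Cx R) x) = algebraMap R (Cx R) x := by
  ext <;> simp

theorem aeval_star (z : Cx R) (g : R[X]) : aeval (star z) g = star (aeval z g) := by
  induction g using Polynomial.induction_on' with
  | add p q hp hq => simp [hp, hq]
  | monomial n a => simp [aeval_monomial, star_algebraMap_cx]

theorem cxMult_algebraMap (f : R[X]) (x : R) :
    cxMult f (algebraMap R (Cx R) x) = f.rootMultiplicity x :=
  (eq_rootMultiplicity_map (FaithfulSMul.algebraMap_injective R (Cx R)) x).symm

theorem cxMult_star (f : R[X]) (z : Cx R) : cxMult f (star z) = cxMult f z := by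
  have h : (f.map (algebraMap R (Cx R))).map (starRingEnd (Cx R)) = f.map (algebraMap R (Cx R)) := by
    rw [Polynomial.map_map]
    congr 1
    exact RingHom.ext fun x => star_algebraMap_cx x
  conv_rhs => rw [cxMult, eq_rootMultiplicity_map (f := starRingEnd (Cx R)) star_injective z, h]
  rfl

theorem cxMult_pos {f : R[X]} (hf : f ≠ 0) {z : Cx R} (hz : aeval z f = 0) : 0 < cxMult f z := by
  rw [cxMult, rootMultiplicity_pos (map_ne_zero hf), IsRoot, eval_map_algebraMap, hz]

/-- The roots in `R[i]` are the real roots and the pairs of conjugate roots. -/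
theorem prod_cxRoots {M : Type*} [CommMonoid M] {f : R[X]} (hf : f ≠ 0) (G : Cx R → M) :
    ∏ z ∈ cxRoots f, G z = (∏ x ∈ f.roots.toFinset, G (algebraMap R (Cx R) x)) *
      ((∏ z ∈ upperRoots f, G z) * ∏ z ∈ upperRoots f, G (star z)) := by
  rw [← Finset.prod_filter_mul_prod_filter_not (cxRoots f) (fun z => z.im = 0)]
  congr 1
  · refine (Finset.prod_bij (fun x _ => algebraMap R (Cx R) x) ?_ ?_ ?_ ?_).symm
    · intro x hx
      rw [Multiset.mem_toFinset, mem_roots hf, IsRoot] at hx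
      rw [Finset.mem_filter, mem_cxRoots hf, aeval_algebraMap_cx, hx]
      simp
    · exact fun x _ y _ h => FaithfulSMul.algebraMap_injective R (Cx R) h
    · intro z hz
      rw [Finset.mem_filter, mem_cxRoots hf] at hz
      have hz' : z = algebraMap R (Cx R) z.re := by ext <;> simp [hz.2]
      refine ⟨z.re, ?_, hz'.symm⟩
      have h1 := hz.1
      rw [hz', aeval_algebraMap_cx, FaithfulSMul.algebraMap_eq_zero_iff] at h1
      rw [Multiset.mem_toFinset, mem_roots hf, IsRoot, h1]
    · exact fun _ _ => rfl
  · rw [← Finset.prod_filter_mul_prod_filter_not _ (fun z : Cx R => 0 < z.im)]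
    congr 1
    · refine Finset.prod_congr ?_ fun _ _ => rfl
      ext z
      simp only [Finset.mem_filter, upperRoots]
      exact ⟨fun h => ⟨h.1.1, h.2⟩, fun h => ⟨⟨h.1, h.2.ne'⟩, h.2⟩⟩
    · refine (Finset.prod_bij (fun z _ => star z) ?_ ?_ ?_ ?_).symm
      · intro z hz
        rw [mem_upperRoots hf] at hz
        simp only [Finset.mem_filter, mem_cxRoots hf, aeval_star, hz.1]
        simp [hz.2.ne', hz.2.le]
      · exact fun _ _ _ _ h => star_injective h
      · intro z hz
        simp only [Finset.mem_filter, mem_cxRoots hf, not_lt] at hz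
        refine ⟨star z, ?_, star_star z⟩
        rw [mem_upperRoots hf, aeval_star, hz.1.1]
        simp [hz.2.lt_of_ne hz.1.2]
      · exact fun _ _ => rfl

theorem sum_cxRoots {M : Type*} [AddCommMonoid M] {f : R[X]} (hf : f ≠ 0) (G : Cx R → M) :
    ∑ z ∈ cxRoots f, G z = (∑ x ∈ f.roots.toFinset, G (algebraMap R (Cx R) x)) +
      ((∑ z ∈ upperRoots f, G z) + ∑ z ∈ upperRoots f, G (star z)) :=
  prod_cxRoots (M := Multiplicative M) hf G

/-- The linear form `g ↦ tr(A g)` on `R[y]/(f)`, whose Hankel form is the Hermite form. -/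
def traceForm (f A : R[X]) : R[X] →ₗ[R] R :=
  Algebra.trace R (AdjoinRoot f) ∘ₗ (AdjoinRoot.mkₐ f).toLinearMap ∘ₗ LinearMap.mulLeft R A

omit [LinearOrder R] [IsStrictOrderedRing R] in
theorem traceForm_apply (f A g : R[X]) :
    traceForm f A g = Algebra.trace R (AdjoinRoot f) (AdjoinRoot.mk f (A * g)) := rfl

omit [LinearOrder R] [IsStrictOrderedRing R] in
theorem traceForm_neg (f A : R[X]) : traceForm f (-A) = -traceForm f A := by
  ext n
  simp [traceForm_apply]

variable [IsRealClosed R]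

theorem algebraMap_traceForm {f : R[X]} (hf : f.Monic) (A g : R[X]) :
    algebraMap R (Cx R) (traceForm f A g) =
      ∑ z ∈ cxRoots f, (cxMult f z : Cx R) * (aeval z A * aeval z g) := by
  rw [traceForm_apply, map_trace_mk _ hf, Finset.sum_multiset_map_count]
  refine Finset.sum_congr rfl fun z _ => ?_
  rw [count_roots, nsmul_eq_mul, eval_map_algebraMap, map_mul]
  rfl

/-- Conjugate roots have the same multiplicity and contribute conjugate terms, hence the doubled
real parts. -/
theorem traceForm_eq_sum {f : R[X]} (hf : f.Monic) (A g : R[X]) :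
    traceForm f A g =
      ∑ x ∈ f.roots.toFinset, (f.rootMultiplicity x : R) * (A.eval x * g.eval x) +
        2 * ∑ z ∈ upperRoots f, (cxMult f z : R) * (aeval z A * aeval z g).re := by
  have hre : ∀ (n : ℕ) (z : Cx R), ((n : Cx R) * z).re = n * z.re := fun n z => by simp
  have h1 := congrArg (QuadraticAlgebra.reₗ (-1) 0) (algebraMap_traceForm hf A g)
  simp only [map_sum, QuadraticAlgebra.reₗ_apply, QuadraticAlgebra.algebraMap_re, hre] at h1
  rw [h1, sum_cxRoots hf.ne_zero]
  simp only [aeval_star, cxMult_star, cxMult_algebraMap, aeval_algebraMap_cx, ← star_mul',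
    ← map_mul, QuadraticAlgebra.algebraMap_re, QuadraticAlgebra.re_star, zero_mul,
    add_zero]
  rw [two_mul]

/-- Send `g` to its values at the real roots with `A > 0` and to the real parts of `w(z) g(z)` at
the upper roots, where `w(z)² = A(z)`. On the kernel every remaining term of the Hermite form is
nonpositive, since `Re (A g²) = -(Im (w g))²`. Nonnegativity makes all of them vanish. Then `g` is
zero at every root where `A ≠ 0`, which is more roots than its degree allows, so the map is
injective on the subspace. -/
theorem finrank_le_of_hankelNonneg {f : R[X]} (hf : f.Monic) (A : R[X]) {n : ℕ}
    (h : HankelNonneg (traceForm f A) ((cxRoots f).filter fun z => aeval z A ≠ 0).card n) :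
    n ≤ (f.roots.toFinset.filter fun x => 0 < A.eval x).card +
      ((upperRoots f).filter fun z => aeval z A ≠ 0).card := by
  obtain ⟨T, hT, rfl, hTL⟩ := h
  choose w hw using fun z : Cx R => Cx.isSquare (aeval z A)
  let S₁ := f.roots.toFinset.filter fun x => 0 < A.eval x
  let S₂ := (upperRoots f).filter fun z => aeval z A ≠ 0
  let Ψ : R[X] →ₗ[R] (S₁ ⊕ S₂ → R) := LinearMap.pi (Sum.elim
    (fun x => (aeval (x : R)).toLinearMap)
    (fun z => QuadraticAlgebra.reₗ (-1) 0 ∘ₗ LinearMap.mulLeft R (w z) ∘ₗ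
      (aeval (z : Cx R)).toLinearMap))
  have hinj : Function.Injective (Ψ ∘ₗ T.subtype) := by
    rw [← LinearMap.ker_eq_bot, LinearMap.ker_eq_bot']
    rintro ⟨g, hg⟩ hΨ
    have hx : ∀ x ∈ f.roots.toFinset, 0 < A.eval x → g.eval x = 0 := fun x hx hA => by
      simpa [Ψ, coe_aeval_eq_eval] using congrFun hΨ (Sum.inl ⟨x, Finset.mem_filter.2 ⟨hx, hA⟩⟩)
    have hz : ∀ z ∈ upperRoots f, aeval z A ≠ 0 → (w z * aeval z g).re = 0 := fun z hz hA => by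
      simpa [Ψ] using congrFun hΨ (Sum.inr ⟨z, Finset.mem_filter.2 ⟨hz, hA⟩⟩)
    have hx' : ∀ x ∈ f.roots.toFinset,
        (f.rootMultiplicity x : R) * (A.eval x * (g * g).eval x) ≤ 0 := fun x h1 => by
      refine mul_nonpos_of_nonneg_of_nonpos (Nat.cast_nonneg _) ?_
      rcases lt_or_ge 0 (A.eval x) with h2 | h2
      · simp [hx x h1 h2]
      · rw [eval_mul]
        exact mul_nonpos_of_nonpos_of_nonneg h2 (mul_self_nonneg _)
    have hre : ∀ z ∈ upperRoots f, (aeval z A * aeval z (g * g)).re =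
        -((w z * aeval z g).im * (w z * aeval z g).im) := fun z h1 => by
      by_cases h2 : aeval z A = 0
      · have h3 : w z = 0 := by simpa [h2] using (hw z).symm
        simp [h2, h3]
      · have h3 := hz z h1 h2
        rw [hw z, map_mul, mul_mul_mul_comm, QuadraticAlgebra.re_mul, h3]
        ring
    have hz' : ∀ z ∈ upperRoots f,
        (cxMult f z : R) * (aeval z A * aeval z (g * g)).re ≤ 0 := fun z h1 => by
      rw [hre z h1]
      exact mul_nonpos_of_nonneg_of_nonpos (Nat.cast_nonneg _)
        (neg_nonpos.2 (mul_self_nonneg _))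
    have h0 := hTL g hg
    rw [traceForm_eq_sum hf] at h0
    have h1 := Finset.sum_nonpos hx'
    have h2 := Finset.sum_nonpos hz'
    have h3 := (Finset.sum_eq_zero_iff_of_nonpos hx').1 (by linarith)
    have h4 := (Finset.sum_eq_zero_iff_of_nonpos hz').1 (by linarith)
    have hxx : ∀ x ∈ f.roots.toFinset, A.eval x ≠ 0 → g.eval x = 0 := fun x hx hA => by
      have h5 := h3 x hx
      rw [mul_eq_zero, mul_eq_zero, or_iff_right hA, or_iff_right] at h5
      · simpa using h5
      · rw [Multiset.mem_toFinset, mem_roots hf.ne_zero] at hx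
        exact_mod_cast ((rootMultiplicity_pos hf.ne_zero).2 hx).ne'
    have hzz : ∀ z ∈ upperRoots f, aeval z A ≠ 0 → aeval z g = 0 := fun z hz1 hA => by
      have h5 := h4 z hz1
      rw [hre z hz1, mul_eq_zero, neg_eq_zero, mul_self_eq_zero, or_iff_right] at h5
      · have h6 : w z * aeval z g = 0 := by
          ext
          · exact hz z hz1 hA
          · exact h5
        refine (mul_eq_zero.1 h6).resolve_left fun h7 => hA ?_
        rw [hw z, h7, zero_mul]
      · exact_mod_cast (cxMult_pos hf.ne_zero ((mem_upperRoots hf.ne_zero).1 hz1).1).ne'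
    have hall : ∀ z ∈ (cxRoots f).filter fun z => aeval z A ≠ 0,
        (g.map (algebraMap R (Cx R))).eval z = 0 := by
      intro z hz1
      rw [Finset.mem_filter, mem_cxRoots hf.ne_zero] at hz1
      rw [eval_map_algebraMap]
      rcases lt_trichotomy z.im 0 with him | him | him
      · have h5 : aeval (star z) g = 0 := by
          refine hzz _ ?_ ?_
          · rw [mem_upperRoots hf.ne_zero, aeval_star, hz1.1]; simpa using him
          · rw [aeval_star]; simpa using hz1.2
        rw [aeval_star] at h5
        simpa using h5
      · have h5 : z = algebraMap R (Cx R) z.re := by ext <;> simp [him]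
        obtain ⟨h6, h7⟩ := hz1
        rw [h5, aeval_algebraMap_cx] at h6 h7 ⊢
        rw [FaithfulSMul.algebraMap_eq_zero_iff] at h6
        rw [hxx _ (by rwa [Multiset.mem_toFinset, mem_roots hf.ne_zero])
          (fun h => h7 (by rw [h, map_zero])), map_zero]
      · exact hzz z ((mem_upperRoots hf.ne_zero).2 ⟨hz1.1, him⟩) hz1.2
    have h5 : g.map (algebraMap R (Cx R)) = 0 := by
      refine eq_zero_of_degree_lt_of_eval_finset_eq_zero _ ?_ hall
      rw [degree_map]
      exact mem_degreeLT.1 (hT hg)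
    have h6 : g = 0 :=
      (Polynomial.map_eq_zero_iff (FaithfulSMul.algebraMap_injective R (Cx R))).1 h5
    simp [h6]
  have : Module.finrank R T ≤ Module.finrank R (S₁ ⊕ S₂ → R) := by
    exact LinearMap.finrank_le_finrank_of_injective hinj
  simpa [S₁, S₂] using this

/-- A kernel vector is a polynomial `g` of degree less than `#S` with `tr(A X^i g) = 0` for `i <
#S`. The Vandermonde matrix of the roots in `S` is invertible, so `g` vanishes on `S` and is zero.
-/
theorem hankelMinor_traceForm_ne_zero {f : R[X]} (hf : f.Monic) (A : R[X]) :
    hankelMinor (traceForm f A) ((cxRoots f).filter fun z => aeval z A ≠ 0).card ≠ 0 := by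
  set S := (cxRoots f).filter fun z => aeval z A ≠ 0 with hS
  intro h0
  obtain ⟨v, hv, hv0⟩ := Matrix.exists_mulVec_eq_zero_iff.2 h0
  let g : R[X] := ∑ k : Fin S.card, C (v k) * X ^ (k : ℕ)
  have hgL : ∀ i < S.card, traceForm f A (X ^ i * g) = 0 := fun i hi => by
    have h1 := congrFun hv0 ⟨i, hi⟩
    simp only [Matrix.mulVec, dotProduct, Matrix.of_apply, Pi.zero_apply] at h1
    rw [Finset.mul_sum, map_sum, ← h1]
    refine Finset.sum_congr rfl fun k _ => ?_
    rw [mul_left_comm, ← pow_add, ← smul_eq_C_mul, map_smul, smul_eq_mul, mul_comm]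
  have hzero : (fun k : Fin S.card => (cxMult f (S.equivFin.symm k) : Cx R) *
      (aeval (S.equivFin.symm k : Cx R) A * aeval (S.equivFin.symm k : Cx R) g)) = 0 := by
    refine Matrix.eq_zero_of_forall_pow_sum_mul_pow_eq_zero
      (f := fun k => (S.equivFin.symm k : Cx R))
      (Subtype.val_injective.comp S.equivFin.symm.injective) fun i => ?_
    have h1 := algebraMap_traceForm hf A (X ^ (i : ℕ) * g)
    rw [hgL i i.2, map_zero, ← Finset.sum_filter_of_ne (p := fun z => aeval z A ≠ 0)] at h1
    · rw [← hS, ← Finset.sum_coe_sort, ← Equiv.sum_comp S.equivFin.symm] at h1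
      rw [h1]
      refine Finset.sum_congr rfl fun k _ => ?_
      simp only [map_mul, map_pow, aeval_X]
      ring
    · intro z _ h2 h3
      simp [h3] at h2
  have hg0 : ∀ z ∈ S, (g.map (algebraMap R (Cx R))).eval z = 0 := fun z hz => by
    have h1 := congrFun hzero (S.equivFin ⟨z, hz⟩)
    simp only [Equiv.symm_apply_apply, Pi.zero_apply] at h1
    rw [hS, Finset.mem_filter, mem_cxRoots hf.ne_zero] at hz
    rw [mul_eq_zero, mul_eq_zero, or_iff_right hz.2, or_iff_right] at h1
    · rw [eval_map_algebraMap, h1]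
    · exact_mod_cast (cxMult_pos hf.ne_zero hz.1).ne'
  have hgd : g ∈ degreeLT R S.card := Submodule.sum_mem _ fun k _ => mem_degreeLT.2
    ((degree_C_mul_X_pow_le _ _).trans_lt (by exact_mod_cast k.2))
  have hg : g = 0 := (Polynomial.map_eq_zero_iff (FaithfulSMul.algebraMap_injective R (Cx R))).1
    (eq_zero_of_degree_lt_of_eval_finset_eq_zero S
      (by rw [degree_map]; exact mem_degreeLT.1 hgd) hg0)
  refine hv (funext fun k => ?_)
  have h1 := congrArg (fun p => p.coeff (k : ℕ)) hg
  simpa [g, finsetSum_coeff, coeff_C_mul, coeff_X_pow, Fin.val_inj] using h1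

/-- The coefficients of `∏ (X - z)`, over the roots where `A ≠ 0`, form a kernel vector over `R[i]`.
With the preceding lemma, the rank is the largest size of a nonzero minor, hence visible in the
signs. -/
theorem hankelMinor_traceForm_eq_zero {f : R[X]} (hf : f.Monic) (A : R[X]) {j : ℕ}
    (hj : ((cxRoots f).filter fun z => aeval z A ≠ 0).card < j) :
    hankelMinor (traceForm f A) j = 0 := by
  set S := (cxRoots f).filter fun z => aeval z A ≠ 0 with hS
  let g : (Cx R)[X] := ∏ z ∈ S, (X - C z)
  have hgm : g.Monic := monic_prod_of_monic _ _ fun z _ => monic_X_sub_C z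
  have hgd : g.natDegree = S.card := natDegree_finsetProd_X_sub_C_eq_card S _
  have hgS : ∀ z ∈ S, g.eval z = 0 := fun z hz => by
    rw [eval_prod]; exact Finset.prod_eq_zero hz (by simp)
  apply FaithfulSMul.algebraMap_injective R (Cx R)
  rw [map_zero, hankelMinor, RingHom.map_det]
  refine Matrix.exists_mulVec_eq_zero_iff.1 ⟨fun k => g.coeff k, fun h => ?_, ?_⟩
  · have h1 := congrFun h ⟨S.card, hj⟩
    simp only [← hgd, hgm.coeff_natDegree, Pi.zero_apply] at h1
    exact one_ne_zero h1
  · funext i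
    simp only [Matrix.mulVec, dotProduct, RingHom.mapMatrix_apply, Matrix.map_apply,
      Matrix.of_apply, Pi.zero_apply, algebraMap_traceForm hf, Finset.sum_mul]
    rw [Finset.sum_comm]
    refine Finset.sum_eq_zero fun z hz => ?_
    by_cases hA : aeval z A = 0
    · simp [hA]
    · have h1 := hgS z (Finset.mem_filter.2 ⟨hz, hA⟩)
      rw [eval_eq_sum_range' (show g.natDegree < j by omega), Finset.sum_range] at h1
      rw [← mul_zero ((cxMult f z : Cx R) * aeval z A * z ^ (i : ℕ)), ← h1, Finset.mul_sum]
      refine Finset.sum_congr rfl fun k _ => ?_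
      rw [map_pow, aeval_X, pow_add]
      ring

omit [IsRealClosed R] in
theorem card_filter_cxRoots {f : R[X]} (hf : f ≠ 0) (A : R[X]) :
    ((cxRoots f).filter fun z => aeval z A ≠ 0).card =
      (f.roots.toFinset.filter fun x => 0 < A.eval x).card +
        (f.roots.toFinset.filter fun x => A.eval x < 0).card +
        2 * ((upperRoots f).filter fun z => aeval z A ≠ 0).card := by
  simp only [Finset.card_filter]
  rw [sum_cxRoots hf, two_mul, ← Finset.sum_add_distrib (s := f.roots.toFinset)]
  congr 1
  · refine Finset.sum_congr rfl fun x _ => ?_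
    simp only [aeval_algebraMap_cx, ne_eq, FaithfulSMul.algebraMap_eq_zero_iff]
    rcases lt_trichotomy (A.eval x) 0 with h | h | h
    · simp [h, h.ne, h.le]
    · simp [h]
    · simp [h, h.ne', h.le]
  · congr 1
    refine Finset.sum_congr rfl fun x _ => ?_
    simp [aeval_star]

omit [IsStrictOrderedRing R] [IsRealClosed R] in
theorem sum_sign_eval_roots (f A : R[X]) :
    ∑ x ∈ f.roots.toFinset, (SignType.sign (A.eval x) : ℤ) =
      (f.roots.toFinset.filter fun x => 0 < A.eval x).card -
        (f.roots.toFinset.filter fun x => A.eval x < 0).card := by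
  simp only [Finset.card_filter, Nat.cast_sum, ← Finset.sum_sub_distrib]
  refine Finset.sum_congr rfl fun x _ => ?_
  rcases lt_trichotomy (A.eval x) 0 with h | h | h
  · simp [h, h.not_gt]
  · simp [h]
  · simp [h, h.not_gt]

omit [IsRealClosed R] in
theorem card_cxRoots_le (f : R[X]) : (cxRoots f).card ≤ f.natDegree :=
  (Multiset.toFinset_card_le _).trans ((card_roots' _).trans natDegree_map_le)

/-- The signs of the leading principal minors of the Hermite matrix of `f` and `A` determine the
number of roots at which `A` does not vanish. -/
theorem card_filter_eq_of_sign_hankelMinor_eq {f f' A A' : R[X]} (hf : f.Monic) (hf' : f'.Monic)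
    (hd : f'.natDegree = f.natDegree)
    (hs : ∀ j, 1 ≤ j → j ≤ f.natDegree →
      SignType.sign (hankelMinor (traceForm f A) j) =
        SignType.sign (hankelMinor (traceForm f' A') j)) :
    ((cxRoots f).filter fun z => aeval z A ≠ 0).card =
      ((cxRoots f').filter fun z => aeval z A' ≠ 0).card := by
  have hle : ∀ f A : R[X], ((cxRoots f).filter fun z => aeval z A ≠ 0).card ≤ f.natDegree :=
    fun f A => (Finset.card_filter_le _ _).trans (card_cxRoots_le f)
  refine le_antisymm (not_lt.1 fun h => ?_) (not_lt.1 fun h => ?_)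
  · have h1 := hs _ (by omega) (hle f A)
    rw [hankelMinor_traceForm_eq_zero hf' A' h, sign_zero, sign_eq_zero_iff] at h1
    exact hankelMinor_traceForm_ne_zero hf A h1
  · have h1 := hs _ (by omega) (hd ▸ hle f' A')
    rw [hankelMinor_traceForm_eq_zero hf A h, sign_zero, eq_comm, sign_eq_zero_iff] at h1
    exact hankelMinor_traceForm_ne_zero hf' A' h1

/-- The signs of the leading principal minors of the Hermite matrix of `f` and `A` determine the
Tarski query of `A` for `f`. -/
theorem sum_sign_eq_of_sign_hankelMinor_eq {f f' A A' : R[X]} (hf : f.Monic) (hf' : f'.Monic)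
    (hd : f'.natDegree = f.natDegree)
    (hs : ∀ j, 1 ≤ j → j ≤ f.natDegree →
      SignType.sign (hankelMinor (traceForm f A) j) =
        SignType.sign (hankelMinor (traceForm f' A') j)) :
    ∑ x ∈ f.roots.toFinset, (SignType.sign (A.eval x) : ℤ) =
      ∑ x ∈ f'.roots.toFinset, (SignType.sign (A'.eval x) : ℤ) := by
  have hr := card_filter_eq_of_sign_hankelMinor_eq hf hf' hd hs
  have hle : ((cxRoots f).filter fun z => aeval z A ≠ 0).card ≤ f.natDegree :=
    (Finset.card_filter_le _ _).trans (card_cxRoots_le f)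
  obtain ⟨n₁, n₂, hn, h1, h2, h3, h4⟩ := exists_hankelNonneg (L' := traceForm f' A')
    (hankelMinor_traceForm_ne_zero hf A) (fun i hi => by
      rcases Nat.eq_zero_or_pos i with rfl | hi0
      · simp [hankelMinor_zero]
      · exact hs i hi0 (hi.trans hle))
  have hneg : ∀ f A : R[X], ((cxRoots f).filter fun z => aeval z (-A) ≠ 0) =
      ((cxRoots f).filter fun z => aeval z A ≠ 0) := fun f A => by simp
  have hnegu : ∀ f A : R[X], ((upperRoots f).filter fun z => aeval z (-A) ≠ 0) =
      ((upperRoots f).filter fun z => aeval z A ≠ 0) := fun f A => by simp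
  have hnegr : ∀ f A : R[X], (f.roots.toFinset.filter fun x => 0 < (-A).eval x) =
      f.roots.toFinset.filter fun x => A.eval x < 0 := fun f A => by simp
  -- With `p₊`, `p₋` real roots of each sign and `c` upper roots where `A ≠ 0`, this gives `n₁ ≤ p₊
  -- + c` and `n₂ ≤ p₋ + c`, while `n₁ + n₂ = p₊ + p₋ + 2c`. Both are therefore equalities and `p₊ -
  -- p₋ = n₁ - n₂`, for `f` and `f'` alike.
  have e1 := finrank_le_of_hankelNonneg hf A h1
  have e2 := finrank_le_of_hankelNonneg hf (-A) (by rwa [hneg, traceForm_neg])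
  have e3 := finrank_le_of_hankelNonneg hf' A' (by rwa [← hr])
  have e4 := finrank_le_of_hankelNonneg hf' (-A') (by rwa [hneg, ← hr, traceForm_neg])
  rw [hnegu, hnegr] at e2 e4
  have c1 := card_filter_cxRoots hf.ne_zero A
  have c2 := card_filter_cxRoots hf'.ne_zero A'
  rw [sum_sign_eval_roots, sum_sign_eval_roots]
  omega

end Roots

/-! ### Sign determination -/

section SignDetermination

/-- A weight on the sign patterns whose moments with few nonzero exponents all vanish is zero,
provided that its support is small. -/
theorem eq_zero_of_moments_eq_zero (m : ℕ) : ∀ (b : ℕ) (c : (Fin m → SignType) → ℤ),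
    (Finset.univ.filter fun σ => c σ ≠ 0).card < 2 ^ (b + 1) →
    (∀ α : Fin m → ℕ, (∀ i, α i ≤ 2) → (Finset.univ.filter fun i => α i ≠ 0).card ≤ b →
      ∑ σ, c σ * ∏ i, (σ i : ℤ) ^ α i = 0) → c = 0 := by
  induction m with
  | zero =>
    intro b c _ h
    funext σ
    have := h (fun _ => 0) (fun _ => by omega) (by simp)
    rw [Fintype.sum_eq_single σ fun τ hτ => absurd (Subsingleton.elim τ σ) hτ] at this
    simpa using this
  | succ m ih =>
    intro b c hc h
    -- Induction on the number of signs: `d k` is the moment of order `k` in the first sign, a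
    -- weight on the remaining ones.
    let d : ℕ → (Fin m → SignType) → ℤ := fun k σ => ∑ s : SignType, (s : ℤ) ^ k * c (Fin.cons s σ)
    have hsum : ∀ k (α : Fin m → ℕ), ∑ σ, d k σ * ∏ i, (σ i : ℤ) ^ α i =
        ∑ σ, c σ * ∏ i, (σ i : ℤ) ^ (Fin.cons k α : Fin (m + 1) → ℕ) i := by
      intro k α
      rw [← (Fin.consEquiv fun _ => SignType).sum_comp, Fintype.sum_prod_type, Finset.sum_comm]
      refine Finset.sum_congr rfl fun σ _ => ?_
      rw [Finset.sum_mul]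
      refine Finset.sum_congr rfl fun s _ => ?_
      simp [Fin.consEquiv, Fin.prod_univ_succ]
      ring
    have hcard : ∀ k (α : Fin m → ℕ), (Finset.univ.filter fun i =>
        (Fin.cons k α : Fin (m + 1) → ℕ) i ≠ 0).card ≤
        (if k = 0 then 0 else 1) + (Finset.univ.filter fun i => α i ≠ 0).card := by
      intro k α
      rw [Fin.card_filter_univ_succ]
      simp only [Fin.cons_zero, Fin.cons_succ]
      split_ifs <;> omega
    have hd0 : d 0 = 0 := by
      refine ih b _ (lt_of_le_of_lt ?_ hc) fun α hα hb => ?_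
      · refine Finset.card_le_card_of_surjOn Fin.tail fun σ hσ => ?_
        simp only [Finset.coe_filter, Finset.mem_univ, true_and, Set.mem_ofPred_eq, d] at hσ
        obtain ⟨s, -, hs⟩ := Finset.exists_ne_zero_of_sum_ne_zero hσ
        exact ⟨Fin.cons s σ, by simpa using hs, by simp⟩
      · rw [hsum]
        exact h _ (fun i => by cases i using Fin.cases <;> simp [hα]) ((hcard 0 α).trans (by simpa))
    -- Since `d 0 = 0`, a nonzero fibre of `c` has at least two nonzero entries. The support of `d
    -- k` is thus at most half that of `c`, which pays for the one nonzero exponent spent on the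
    -- first sign.
    have hsupp : ∀ k, 2 * (Finset.univ.filter fun σ => d k σ ≠ 0).card < 2 ^ (b + 1) := by
      intro k
      refine lt_of_le_of_lt ?_ hc
      refine (Finset.mul_card_image_le_card_of_maps_to (f := Fin.tail)
        (s := Finset.univ.filter fun σ => c σ ≠ 0 ∧ d k (Fin.tail σ) ≠ 0)
        (fun σ hσ => by simpa using (Finset.mem_filter.1 hσ).2.2) 2 fun σ hσ => ?_).trans
        (Finset.card_le_card fun σ hσ => by simpa using (Finset.mem_filter.1 hσ).2.1)
      have hσ' : d k σ ≠ 0 := by simpa using hσ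
      obtain ⟨s, -, hs⟩ := Finset.exists_ne_zero_of_sum_ne_zero hσ'
      have hs' : c (Fin.cons s σ) ≠ 0 := right_ne_zero_of_mul hs
      obtain ⟨t, hts, ht⟩ : ∃ t, t ≠ s ∧ c (Fin.cons t σ) ≠ 0 := by
        by_contra! hall
        have h1 := congrFun hd0 σ
        simp only [d, pow_zero, one_mul, Pi.zero_apply] at h1
        rw [Fintype.sum_eq_single s hall] at h1
        exact hs' h1
      refine Finset.one_lt_card.2 ⟨Fin.cons s σ, ?_, Fin.cons t σ, ?_, fun h => hts ?_⟩
      · simp [hs', hσ']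
      · simp [ht, hσ']
      · simpa using (congrFun h 0).symm
    have hdk : ∀ k, 1 ≤ k → k ≤ 2 → d k = 0 := by
      intro k hk hk2
      rcases b with _ | b
      · have h1 := hsupp k
        have h2 : (Finset.univ.filter fun σ => d k σ ≠ 0).card = 0 := by omega
        rw [Finset.card_eq_zero, Finset.filter_eq_empty_iff] at h2
        funext σ
        simpa using h2 (Finset.mem_univ σ)
      · refine ih b _ (by have := hsupp k; rw [pow_succ] at this; omega) fun α hα hb => ?_
        rw [hsum]
        exact h _ (fun i => by cases i using Fin.cases <;> simp [hα, hk2])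
          ((hcard k α).trans (by split_ifs <;> omega))
    funext σ
    -- The moments of orders 0, 1, 2 determine a weight on `{-1, 0, 1}`.
    have e0 := congrFun hd0 (Fin.tail σ)
    have e1 := congrFun (hdk 1 le_rfl (by omega)) (Fin.tail σ)
    have e2 := congrFun (hdk 2 (by omega) le_rfl) (Fin.tail σ)
    have huniv : ∀ F : SignType → ℤ, ∑ s, F s = F 0 + F (-1) + F 1 := fun F => by
      rw [show (Finset.univ : Finset SignType) = {0, -1, 1} from rfl]
      simp [add_assoc]
    simp only [d, huniv, Pi.zero_apply] at e0 e1 e2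
    simp at e0 e1 e2
    rw [← Fin.cons_self_tail σ, Pi.zero_apply]
    generalize σ 0 = s
    cases s
    · change c (Fin.cons 0 _) = 0; omega
    · change c (Fin.cons (-1) _) = 0; omega
    · change c (Fin.cons 1 _) = 0; omega

theorem sum_fiber_mul_prod {ι : Type*} {m : ℕ} (X : Finset ι) (F : ι → Fin m → SignType)
    (w : ι → ℤ) (α : Fin m → ℕ) :
    ∑ σ, (∑ x ∈ X.filter (fun x => F x = σ), w x) * ∏ i, (σ i : ℤ) ^ α i =
      ∑ x ∈ X, w x * ∏ i, (F x i : ℤ) ^ α i := by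
  rw [← Finset.sum_fiberwise X F]
  refine Finset.sum_congr rfl fun σ _ => ?_
  rw [Finset.sum_mul]
  refine Finset.sum_congr rfl fun x hx => ?_
  rw [(Finset.mem_filter.1 hx).2]

/-- Weighted counts of sign patterns are determined by the moments with few nonzero exponents. -/
theorem sum_filter_eq_of_moments_eq {ι κ : Type*} {m b : ℕ} (X : Finset ι) (Y : Finset κ)
    (F : ι → Fin m → SignType) (G : κ → Fin m → SignType) (w : ι → ℤ) (w' : κ → ℤ)
    (hcard : (X.image F ∪ Y.image G).card < 2 ^ (b + 1))
    (h : ∀ α : Fin m → ℕ, (∀ i, α i ≤ 2) → (Finset.univ.filter fun i => α i ≠ 0).card ≤ b →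
      ∑ x ∈ X, w x * ∏ i, (F x i : ℤ) ^ α i = ∑ y ∈ Y, w' y * ∏ i, (G y i : ℤ) ^ α i)
    (σ : Fin m → SignType) :
    ∑ x ∈ X.filter (fun x => F x = σ), w x = ∑ y ∈ Y.filter (fun y => G y = σ), w' y := by
  let c : (Fin m → SignType) → ℤ := fun σ =>
    ∑ x ∈ X.filter (fun x => F x = σ), w x - ∑ y ∈ Y.filter (fun y => G y = σ), w' y
  suffices hc : c = 0 from sub_eq_zero.1 (congrFun hc σ)
  refine eq_zero_of_moments_eq_zero m b c (lt_of_le_of_lt (Finset.card_le_card ?_) hcard) ?_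
  · intro σ hσ
    by_contra hn
    simp only [Finset.mem_union, Finset.mem_image, not_or, not_exists, not_and] at hn
    refine (Finset.mem_filter.1 hσ).2 ?_
    simp only [c]
    rw [Finset.filter_eq_empty_iff.2 fun x hx => hn.1 x hx,
      Finset.filter_eq_empty_iff.2 fun x hx => hn.2 x hx]
    simp
  · intro α hα hb
    simp only [c, sub_mul, Finset.sum_sub_distrib]
    rw [sum_fiber_mul_prod, sum_fiber_mul_prod, h α hα hb, sub_self]

theorem card_filter_eq_of_moments_eq {ι κ : Type*} {m b : ℕ} (X : Finset ι) (Y : Finset κ)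
    (F : ι → Fin m → SignType) (G : κ → Fin m → SignType) (hcard : X.card + Y.card < 2 ^ (b + 1))
    (h : ∀ α : Fin m → ℕ, (∀ i, α i ≤ 2) → (Finset.univ.filter fun i => α i ≠ 0).card ≤ b →
      ∑ x ∈ X, ∏ i, (F x i : ℤ) ^ α i = ∑ y ∈ Y, ∏ i, (G y i : ℤ) ^ α i)
    (σ : Fin m → SignType) :
    (X.filter fun x => F x = σ).card = (Y.filter fun y => G y = σ).card := by
  have := sum_filter_eq_of_moments_eq X Y F G (fun _ => 1) (fun _ => 1)
    (((Finset.card_union_le _ _).trans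
      (add_le_add Finset.card_image_le Finset.card_image_le)).trans_lt hcard)
    (by simpa using h) σ
  simpa using this

end SignDetermination

/-! ### Invariance under parameters with the same signs -/

section Families

variable {A : Type*} [CommRing A]

theorem prod_iterate_derivative_mem_pder (P : A[X]) {b : ℕ} (α : Fin (P.natDegree - 1) → ℕ)
    (hα : ∀ i, α i ≤ 2) (hb : (Finset.univ.filter fun i => α i ≠ 0).card ≤ b) :
    ∏ i : Fin (P.natDegree - 1), (derivative^[(i : ℕ) + 1] P) ^ α i ∈ pder b P := by
  let β : ℕ → ℕ := fun h => if hh : h - 1 < P.natDegree - 1 then α ⟨h - 1, hh⟩ else 0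
  refine ⟨β, fun h => ?_, le_trans ?_ hb, ?_⟩
  · simp only [β]; split_ifs
    · exact hα _
    · omega
  · refine Finset.card_le_card_of_surjOn (fun i : Fin (P.natDegree - 1) => (i : ℕ) + 1) fun h hh => ?_
    simp only [Finset.coe_filter, Finset.mem_Icc, Set.mem_ofPred_eq] at hh
    have h1 : h - 1 < P.natDegree - 1 := by omega
    refine ⟨⟨h - 1, h1⟩, ?_, by simp; omega⟩
    simpa [β, h1] using hh.2
  · refine Finset.prod_bij (fun i _ => (i : ℕ) + 1) (fun i _ => ?_) (fun i _ j _ h => ?_)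
      (fun h hh => ?_) fun i _ => ?_
    · rw [Finset.mem_Icc]; omega
    · exact Fin.ext (by omega)
    · rw [Finset.mem_Icc] at hh
      exact ⟨⟨h - 1, by omega⟩, Finset.mem_univ _, by simp; omega⟩
    · simp [β]

variable {R : Type*} [Field R] [LinearOrder R] [IsStrictOrderedRing R]

/-- The signs of the derivatives of `P`, specialized by `φ`, at `x`. -/
def signPattern (φ : A →+* R) (P : A[X]) (x : R) : Fin (P.natDegree - 1) → SignType :=
  fun i => SignType.sign ((derivative^[(i : ℕ) + 1] (P.map φ)).eval x)

open Classical in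
/-- The zero pattern of the derivatives of `P`, specialized by `φ`, at `z`. -/
def zeroPattern (φ : A →+* R) (P : A[X]) (z : Cx R) : Fin (P.natDegree - 1) → SignType :=
  fun i => if aeval z (derivative^[(i : ℕ) + 1] (P.map φ)) = 0 then 0 else 1

theorem sign_eval_prod (φ : A →+* R) (P : A[X]) (x : R) (α : Fin (P.natDegree - 1) → ℕ) :
    (SignType.sign (((∏ i : Fin (P.natDegree - 1), (derivative^[(i : ℕ) + 1] P) ^ α i).map φ).eval x)
      : ℤ) = ∏ i, (signPattern φ P x i : ℤ) ^ α i := by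
  rw [Polynomial.map_prod, eval_prod]
  have h : ∀ (g : Fin (P.natDegree - 1) → R),
      (SignType.sign (∏ i, g i) : ℤ) = ∏ i, (SignType.sign (g i) : ℤ) := fun g => by
    have h1 : SignType.sign (∏ i, g i) = ∏ i, SignType.sign (g i) := map_prod signHom g _
    rw [h1]
    exact map_prod SignType.castHom _ _
  rw [h]
  refine Finset.prod_congr rfl fun i _ => ?_
  rw [Polynomial.map_pow, eval_pow, sign_pow, signPattern, ← iterate_derivative_map,
    SignType.coe_pow]

/-- Coding "zero or not" by the signs 0 and 1 lets the moment argument also count complex roots: the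
moments become ranks of Hermite forms. -/
theorem prod_zeroPattern (φ : A →+* R) (P : A[X]) (z : Cx R)
    (α : Fin (P.natDegree - 1) → ℕ) :
    (∏ i, (zeroPattern φ P z i : ℤ) ^ α i) =
      if aeval z ((∏ i : Fin (P.natDegree - 1), (derivative^[(i : ℕ) + 1] P) ^ α i).map φ) ≠ 0 then 1 else 0 := by
  rw [Polynomial.map_prod, map_prod]
  simp only [Polynomial.map_pow, map_pow, ← iterate_derivative_map]
  split_ifs with h
  · rw [Finset.prod_ne_zero_iff] at h
    refine Finset.prod_eq_one fun i hi => ?_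
    by_cases h0 : α i = 0
    · simp [h0]
    · have := (pow_ne_zero_iff h0).1 (h i hi)
      rw [zeroPattern, if_neg this]
      simp
  · rw [not_not, Finset.prod_eq_zero_iff] at h
    obtain ⟨i, hi, h⟩ := h
    refine Finset.prod_eq_zero hi ?_
    have h0 : α i ≠ 0 := by rintro h0; simp [h0] at h
    rw [pow_eq_zero_iff h0] at h
    rw [zeroPattern, if_pos h]
    simp [h0]

variable [IsRealClosed R]

/-- Traces commute with specialization, because both sides are the same sum over the roots in
`R[i]`. -/
theorem map_trace_mk_eq (φ : A →+* R) {P : A[X]} (hP : P.Monic) (g : A[X]) :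
    φ (Algebra.trace A (AdjoinRoot P) (AdjoinRoot.mk P g)) =
      Algebra.trace R (AdjoinRoot (P.map φ)) (AdjoinRoot.mk (P.map φ) (g.map φ)) := by
  apply FaithfulSMul.algebraMap_injective R (Cx R)
  rw [map_trace_mk _ (hP.map φ), ← RingHom.comp_apply, map_trace_mk _ hP, Polynomial.map_map,
    Polynomial.map_map]

theorem map_hermiteMinor (φ : A →+* R) {P : A[X]} (hP : P.Monic) (a : A[X]) {j : ℕ}
    (hj : j ≤ P.natDegree) :
    φ ((hermite P a).submatrix (Fin.castLE hj) (Fin.castLE hj)).det =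
      hankelMinor (traceForm (P.map φ) (a.map φ)) j := by
  rw [RingHom.map_det, hankelMinor]
  congr 1
  ext i l
  have := map_trace_mk_eq φ hP (a * X ^ ((i : ℕ) + (l : ℕ)))
  rw [Polynomial.map_mul, Polynomial.map_pow, map_X] at this
  exact this

variable {φ φ' : A →+* R} {Q : Finset A[X]} (hQ : ∀ P ∈ Q, P.Monic)
  (hs : ∀ f ∈ elimFamily Q, SignType.sign (φ f) = SignType.sign (φ' f))
include hQ hs

theorem sign_hankelMinor_eq_of_mem_pder {P : A[X]} (hP : P ∈ Q) {a : A[X]}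
    (ha : a ∈ pder (Nat.size P.natDegree) P) {j : ℕ} (h1 : 1 ≤ j) (hj : j ≤ P.natDegree) :
    SignType.sign (hankelMinor (traceForm (P.map φ) (a.map φ)) j) =
      SignType.sign (hankelMinor (traceForm (P.map φ') (a.map φ')) j) := by
  rw [← map_hermiteMinor φ (hQ P hP) a hj, ← map_hermiteMinor φ' (hQ P hP) a hj]
  exact hs _ (Or.inl ⟨P, hP, a, ha, j, h1, hj, rfl⟩)

theorem sign_hankelMinor_eq_of_mem_pderWith {P q : A[X]} (hP : P ∈ Q)
    (hq : q ∈ derPlusFamily Q \ derPlus P) {a : A[X]}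
    (ha : a ∈ pderWith (Nat.size P.natDegree - 1) P q) {j : ℕ} (h1 : 1 ≤ j)
    (hj : j ≤ P.natDegree) :
    SignType.sign (hankelMinor (traceForm (P.map φ) (a.map φ)) j) =
      SignType.sign (hankelMinor (traceForm (P.map φ') (a.map φ')) j) := by
  rw [← map_hermiteMinor φ (hQ P hP) a hj, ← map_hermiteMinor φ' (hQ P hP) a hj]
  exact hs _ (Or.inr ⟨P, hP, q, hq, a, ha, j, h1, hj, rfl⟩)

/-- The two specializations together have at most `2p` real roots, and `2p < 2 ^ (bit{p} + 1)`:
moments with `bit{p}` nonzero exponents suffice. -/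
theorem card_signPattern_eq {P : A[X]} (hP : P ∈ Q) (σ : Fin (P.natDegree - 1) → SignType) :
    ((P.map φ).roots.toFinset.filter fun x => signPattern φ P x = σ).card =
      ((P.map φ').roots.toFinset.filter fun x => signPattern φ' P x = σ).card := by
  have hm := hQ P hP
  have hle : ∀ ψ : A →+* R, (P.map ψ).roots.toFinset.card ≤ P.natDegree := fun ψ =>
    (Multiset.toFinset_card_le _).trans ((card_roots' _).trans natDegree_map_le)
  refine card_filter_eq_of_moments_eq (b := Nat.size P.natDegree) _ _ _ _ ?_ (fun α hα hb => ?_) σ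
  · have := Nat.lt_size_self P.natDegree
    have := hle φ
    have := hle φ'
    rw [pow_succ]; omega
  · have := sum_sign_eq_of_sign_hankelMinor_eq (hm.map φ) (hm.map φ')
      (by rw [hm.natDegree_map, hm.natDegree_map]) fun j h1 hj =>
        sign_hankelMinor_eq_of_mem_pder hQ hs hP (prod_iterate_derivative_mem_pder P α hα hb) h1
          (by rwa [hm.natDegree_map] at hj)
    simpa only [sign_eval_prod] using this

/-- By `card_signPattern_eq` the same patterns occur on both sides, so there are at most `p < 2 ^
bit{p}` of them in all. This saves one exponent and explains the bound `bit{p} - 1` in `thElimWith`.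
-/
theorem sum_sign_signPattern_eq {P q : A[X]} (hP : P ∈ Q)
    (hq : q ∈ derPlusFamily Q \ derPlus P) (σ : Fin (P.natDegree - 1) → SignType) :
    ∑ x ∈ (P.map φ).roots.toFinset.filter (fun x => signPattern φ P x = σ),
        (SignType.sign ((q.map φ).eval x) : ℤ) =
      ∑ x ∈ (P.map φ').roots.toFinset.filter (fun x => signPattern φ' P x = σ),
        (SignType.sign ((q.map φ').eval x) : ℤ) := by
  have hm := hQ P hP
  have himg : (P.map φ').roots.toFinset.image (signPattern φ' P) =
      (P.map φ).roots.toFinset.image (signPattern φ P) := by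
    ext σ
    rw [← Finset.fiber_card_ne_zero_iff_mem_image, ← Finset.fiber_card_ne_zero_iff_mem_image,
      card_signPattern_eq hQ hs hP σ]
  -- In degree zero `Nat.size p - 1` is a truncated subtraction, but then `P = 1` has no roots.
  rcases Nat.eq_zero_or_pos P.natDegree with h0 | h0
  · have hr : ∀ ψ : A →+* R, (P.map ψ).roots.toFinset = ∅ := fun ψ => by
      rw [hm.natDegree_eq_zero.1 h0]; simp
    simp [hr]
  refine sum_filter_eq_of_moments_eq (b := Nat.size P.natDegree - 1) _ _ _ _ _ _ ?_
    (fun α hα hb => ?_) σ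
  · have h1 := Nat.lt_size_self P.natDegree
    have h2 := Nat.size_pos.2 h0
    rw [himg, Finset.union_self, Nat.sub_add_cancel h2]
    exact (Finset.card_image_le.trans ((Multiset.toFinset_card_le _).trans
      ((card_roots' _).trans natDegree_map_le))).trans_lt h1
  · have := sum_sign_eq_of_sign_hankelMinor_eq (hm.map φ) (hm.map φ')
      (by rw [hm.natDegree_map, hm.natDegree_map]) fun j h1 hj =>
        sign_hankelMinor_eq_of_mem_pderWith hQ hs hP hq
          ⟨_, prod_iterate_derivative_mem_pder P α hα hb, q, by simp, rfl⟩ h1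
          (by rwa [hm.natDegree_map] at hj)
    simp only [Polynomial.map_mul, eval_mul, sign_mul, SignType.coe_mul, sign_eval_prod] at this
    simpa only [mul_comm] using this

theorem card_zeroPattern_eq {P : A[X]} (hP : P ∈ Q) (σ : Fin (P.natDegree - 1) → SignType) :
    ((cxRoots (P.map φ)).filter fun x => zeroPattern φ P x = σ).card =
      ((cxRoots (P.map φ')).filter fun x => zeroPattern φ' P x = σ).card := by
  have hm := hQ P hP
  have hle : ∀ ψ : A →+* R, (cxRoots (P.map ψ)).card ≤ P.natDegree := fun ψ =>
    (card_cxRoots_le _).trans natDegree_map_le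
  refine card_filter_eq_of_moments_eq (b := Nat.size P.natDegree) _ _ _ _ ?_ (fun α hα hb => ?_) σ
  · have := Nat.lt_size_self P.natDegree
    have := hle φ
    have := hle φ'
    rw [pow_succ]; omega
  · have := card_filter_eq_of_sign_hankelMinor_eq (hm.map φ) (hm.map φ')
      (by rw [hm.natDegree_map, hm.natDegree_map]) fun j h1 hj =>
        sign_hankelMinor_eq_of_mem_pder hQ hs hP (prod_iterate_derivative_mem_pder P α hα hb) h1
          (by rwa [hm.natDegree_map] at hj)
    simp only [prod_zeroPattern, Finset.sum_boole]
    exact_mod_cast this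

end Families

/-! ### Multiplicities and Thom encodings -/

section Encodings

variable {A : Type*} [CommRing A]
variable {R : Type*} [Field R] [LinearOrder R] [IsStrictOrderedRing R]

/-- The multiplicity of a root at which the derivatives `f', …, f^(m)` of a polynomial of degree
`m + 1` have the signs `σ`. -/
def patternMult {m : ℕ} (σ : Fin m → SignType) : ℕ :=
  sInf {i | 1 ≤ i ∧ ∀ h : i - 1 < m, σ ⟨i - 1, h⟩ ≠ 0}

theorem cxMult_eq_iff {f : R[X]} (hf : f ≠ 0) {z : Cx R} (i : ℕ) :
    i < cxMult f z ↔ ∀ k ≤ i, aeval z (derivative^[k] f) = 0 := by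
  rw [cxMult, lt_rootMultiplicity_iff_isRoot_iterate_derivative (map_ne_zero hf)]
  simp only [iterate_derivative_map, IsRoot, eval_map_algebraMap]

theorem cxMult_le_natDegree (f : R[X]) (z : Cx R) : cxMult f z ≤ f.natDegree := by
  by_cases hf : f = 0
  · simp [cxMult, hf]
  · refine (?_ : _ ≤ (f.map (algebraMap R (Cx R))).natDegree).trans natDegree_map_le
    rw [cxMult, ← count_roots]
    exact (Multiset.count_le_card _ _).trans (card_roots' _)

/-- Common to `mult` and `patternMult`: the multiplicity is the order of the first nonvanishing
derivative. At order `deg f` nothing is required, in accordance with the conventional sign of the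
leading coefficient. -/
theorem sInf_eq_cxMult {f : R[X]} (hf : f ≠ 0) {z : Cx R} (S : Set ℕ)
    (hS : ∀ i ≤ f.natDegree, i ∈ S ↔ i ≠ 0 ∧ (i < f.natDegree → aeval z (derivative^[i] f) ≠ 0))
    (hz : aeval z f = 0) : sInf S = cxMult f z := by
  have hle := cxMult_le_natDegree f z
  have hmem : cxMult f z ∈ S := by
    rw [hS _ hle]
    refine ⟨(cxMult_pos hf hz).ne', fun _ h0 => ?_⟩
    refine lt_irrefl (cxMult f z) ((cxMult_eq_iff hf _).2 fun k hk => ?_)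
    rcases hk.lt_or_eq with h | rfl
    · exact (cxMult_eq_iff hf k).1 h k le_rfl
    · exact h0
  refine le_antisymm (Nat.sInf_le hmem) (le_csInf ⟨_, hmem⟩ fun i hi => not_lt.1 fun hlt => ?_)
  exact ((hS i (hlt.le.trans hle)).1 hi).2 (hlt.trans_le hle)
    ((cxMult_eq_iff hf i).1 hlt i le_rfl)

theorem patternMult_eq_cxMult {f : R[X]} (hf : f ≠ 0) {z : Cx R} (hz : aeval z f = 0) {n : ℕ}
    (hn : f.natDegree = n) (σ : Fin (n - 1) → SignType)
    (hσ : ∀ i, σ i = 0 ↔ aeval z (derivative^[(i : ℕ) + 1] f) = 0) :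
    patternMult σ = cxMult f z := by
  subst hn
  refine sInf_eq_cxMult hf _ (fun i hi => ?_) hz
  simp only [Set.mem_ofPred_eq, ne_eq, hσ]
  rcases i with _ | i
  · simp
  · simp only [Nat.add_sub_cancel]
    exact and_congr (by simp) ⟨fun h h' => h (by omega), fun h h' => h (by omega)⟩

theorem patternMult_zeroPattern (φ : A →+* R) {P : A[X]} (hP : P.Monic) {z : Cx R}
    (hz : aeval z (P.map φ) = 0) : patternMult (zeroPattern φ P z) = cxMult (P.map φ) z := by
  refine patternMult_eq_cxMult (hP.map φ).ne_zero hz (hP.natDegree_map φ) _ fun i => ?_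
  rw [zeroPattern]
  split_ifs with h
  · exact iff_of_true rfl h
  · exact iff_of_false (by decide) h

theorem patternMult_signPattern (φ : A →+* R) {P : A[X]} (hP : P.Monic) {x : R}
    (hx : (P.map φ).eval x = 0) :
    patternMult (signPattern φ P x) = (P.map φ).rootMultiplicity x := by
  rw [← cxMult_algebraMap]
  refine patternMult_eq_cxMult (hP.map φ).ne_zero ?_ (hP.natDegree_map φ) _ fun i => ?_
  · rw [aeval_algebraMap_cx, hx, map_zero]
  · rw [signPattern, sign_eq_zero_iff, aeval_algebraMap_cx, FaithfulSMul.algebraMap_eq_zero_iff]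

/-- The signs at `x` of the polynomials in `Der₊(𝒬)`, specialized by `φ`. -/
def signsAt (φ : A →+* R) (Q : Finset A[X]) (x : R) : SignCond (derPlusFamily Q) :=
  fun q => SignType.sign ((q.1.map φ).eval x)

omit [IsStrictOrderedRing R] in
theorem signOf_signsAt (φ : A →+* R) {Q : Finset A[X]} (x : R) (P : Q) :
    signOf (signsAt φ Q x) P = SignType.sign ((P.1.map φ).eval x) := rfl

/-- At `k = p` the derivative is the positive constant `p!`, which agrees with the default value 1
of `signAt`. -/
theorem signAt_onDerPlus (φ : A →+* R) {Q : Finset A[X]} (hQ : ∀ P ∈ Q, P.Monic) (x : R) (P : Q)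
    {k : ℕ} (hk : k ≤ P.1.natDegree) :
    signAt P.1 (onDerPlus (signsAt φ Q x) P) k =
      SignType.sign ((derivative^[k] (P.1.map φ)).eval x) := by
  rw [signAt]
  split_ifs with h
  · rw [iterate_derivative_map]; rfl
  · obtain rfl : k = P.1.natDegree := by omega
    have hm := (hQ P.1 P.2).map φ
    have h1 : (derivative^[P.1.natDegree] (P.1.map φ)).natDegree ≤ 0 := by
      have := natDegree_iterate_derivative (P.1.map φ) P.1.natDegree
      rwa [(hQ P.1 P.2).natDegree_map, Nat.sub_self] at this
    rw [eq_C_of_natDegree_le_zero h1, eval_C, coeff_iterate_derivative, zero_add,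
      Nat.descFactorial_self]
    have h2 : (P.1.map φ).coeff P.1.natDegree = 1 := by
      conv_lhs => rw [← (hQ P.1 P.2).natDegree_map φ]
      exact hm
    rw [h2, sign_pos]
    simpa using Nat.factorial_pos _

theorem mult_onDer (φ : A →+* R) {Q : Finset A[X]} (hQ : ∀ P ∈ Q, P.Monic) {x : R}
    (P : Q) (hx : (P.1.map φ).eval x = 0) :
    mult P.1 (onDer (signsAt φ Q x) P) = (P.1.map φ).rootMultiplicity x := by
  have hm := hQ P.1 P.2
  have hd := hm.natDegree_map φ
  rw [← cxMult_algebraMap]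
  refine sInf_eq_cxMult (hm.map φ).ne_zero _ (fun i hi => ?_)
    (by rw [aeval_algebraMap_cx, hx, map_zero])
  rw [hd] at hi ⊢
  have hpos : P.1.natDegree ≠ 0 := fun h0 => by
    rw [hm.natDegree_eq_zero.1 h0] at hx; simp at hx
  simp only [Set.mem_ofPred_eq, aeval_algebraMap_cx, ne_eq, FaithfulSMul.algebraMap_eq_zero_iff,
    hi, true_and]
  rcases Nat.eq_zero_or_pos i with rfl | h0
  -- Derivatives of positive order have smaller degree than `P`, so `extendZero` really assigns 0 to
  -- `P` itself.
  · have h1 : P.1 ∉ der P.1 := by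
      rintro ⟨h, h1, h2, h3⟩
      have h4 := natDegree_iterate_derivative P.1 h
      rw [← h3] at h4
      omega
    simp [signAt, extendZero, h1, Nat.pos_of_ne_zero hpos]
  · have h1 : signAt P.1 (extendZero P.1 (onDer (signsAt φ Q x) P)) i =
        signAt P.1 (onDerPlus (signsAt φ Q x) P) i := by
      rw [signAt, signAt]
      split_ifs with h
      · have h2 : derivative^[i] P.1 ∈ der P.1 := ⟨i, h0, h, rfl⟩
        simp only [extendZero, h2, dif_pos]
        rfl
      · rfl
    rw [h1]
    refine ⟨fun h => ⟨h0.ne', fun _ h2 => h ?_⟩, fun h => ?_⟩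
    · rw [signAt_onDerPlus φ hQ x P hi, h2, sign_zero]
    · by_cases h2 : i < P.1.natDegree
      · rw [signAt_onDerPlus φ hQ x P hi, sign_eq_zero_iff]
        exact h.2 h2
      · simp [signAt, h2]

/-- The largest index of disagreement `q` is the same in both directions, and the signs at `q + 1`
agree, being 1 when `q + 1 = p`. Asymmetry is what turns `≺_P` between encodings back into `<`
between roots. -/
theorem ThomLT.asymm {P : A[X]} {η₁ η₂ : SignCond (derPlus P)} (h : ThomLT P η₁ η₂) :
    ¬ ThomLT P η₂ η₁ := by
  rintro ⟨q', hq', hne', hag', hs'⟩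
  obtain ⟨q, hq, hne, hag, hs⟩ := h
  obtain rfl : q = q' := by
    rcases lt_trichotomy q q' with h | h | h
    · exact absurd (hag q' h hq').symm hne'
    · exact h
    · exact absurd (hag' q h hq).symm hne
  have h1 : signAt P η₁ (q + 1) = signAt P η₂ (q + 1) := by
    by_cases h : q + 1 < P.natDegree
    · exact hag _ (Nat.lt_succ_self q) h
    · simp [signAt, h]
  rw [h1] at hs
  rcases hs with ⟨h2, h3⟩ | ⟨h2, h3⟩ <;> rcases hs' with ⟨h4, h5⟩ | ⟨h4, h5⟩
  · exact lt_asymm h2 h4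
  · rw [h3] at h5; exact absurd h5 (by decide)
  · rw [h3] at h5; exact absurd h5 (by decide)
  · exact lt_asymm h2 h4

variable [IsRealClosed R]

/-- If all signs agree, Thom's lemma excludes zeros of `P` at both points. Otherwise `thom_sign_lt`
applies at the largest index of disagreement. -/
theorem eq_or_thomLT_of_lt (φ : A →+* R) {Q : Finset A[X]} (hQ : ∀ P ∈ Q, P.Monic) (P : Q)
    {x y : R} (hxy : x < y) :
    (onDerPlus (signsAt φ Q x) P = onDerPlus (signsAt φ Q y) P ∧
      (P.1.map φ).eval x ≠ 0 ∧ (P.1.map φ).eval y ≠ 0) ∨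
    ThomLT P.1 (onDerPlus (signsAt φ Q x) P) (onDerPlus (signsAt φ Q y) P) := by
  classical
  have hm := (hQ P.1 P.2).map φ
  have hd := (hQ P.1 P.2).natDegree_map φ
  have hsx : ∀ z, ∀ k < P.1.natDegree, signAt P.1 (onDerPlus (signsAt φ Q z) P) k =
      SignType.sign ((derivative^[k] (P.1.map φ)).eval z) :=
    fun z k hk => signAt_onDerPlus φ hQ z P hk.le
  by_cases hall : ∀ k < P.1.natDegree, SignType.sign ((derivative^[k] (P.1.map φ)).eval x) =
      SignType.sign ((derivative^[k] (P.1.map φ)).eval y)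
  · left
    obtain ⟨h1, h2⟩ := thom_sign_const hm.ne_zero hxy (by rwa [hd])
    have h3 := h2 y hxy.le le_rfl
    refine ⟨?_, h1, by rwa [← sign_ne_zero, h3, sign_ne_zero]⟩
    funext ⟨q, hq⟩
    rcases hq with rfl | ⟨h, -, hlt, rfl⟩
    · exact h3.symm
    · have := hall h hlt
      rw [iterate_derivative_map] at this
      exact this
  · right
    push Not at hall
    obtain ⟨q, hq, hmax⟩ := ((Finset.range P.1.natDegree).filter fun k =>
      SignType.sign ((derivative^[k] (P.1.map φ)).eval x) ≠
        SignType.sign ((derivative^[k] (P.1.map φ)).eval y)).exists_max_image id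
      (by obtain ⟨k, hk, hk'⟩ := hall
          exact ⟨k, by simp only [Finset.mem_filter, Finset.mem_range]; exact ⟨hk, hk'⟩⟩)
    simp only [Finset.mem_filter, Finset.mem_range, id] at hq hmax
    have hag : ∀ k, q < k → k < P.1.natDegree →
        SignType.sign ((derivative^[k] (P.1.map φ)).eval x) =
          SignType.sign ((derivative^[k] (P.1.map φ)).eval y) := fun k h1 h2 => by
      by_contra hne
      exact absurd (hmax k ⟨h2, hne⟩) (by omega)
    have key := thom_sign_lt hm.ne_zero hxy (q := q) (by rw [hd]; exact hq.1) hq.2 (by rwa [hd])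
    refine ⟨q, hq.1, ?_, fun k h1 h2 => ?_, ?_⟩
    · rw [hsx _ _ hq.1, hsx _ _ hq.1]; exact hq.2
    · rw [hsx _ _ h2, hsx _ _ h2]; exact hag k h1 h2
    · rw [hsx _ _ hq.1, hsx _ _ hq.1, signAt_onDerPlus φ hQ x P hq.1]
      exact key

end Encodings

/-! ### Transfer of the descriptions of roots between parameters -/

section Transfer

theorem card_filter_eq_sum_card_fiber {ι κ : Type*} [Fintype κ] [DecidableEq κ] (X : Finset ι)
    (F : ι → κ) (M : κ → ℕ) (g : ι → ℕ) (h : ∀ x ∈ X, M (F x) = g x) (n : ℕ) :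
    (X.filter fun x => g x = n).card =
      ∑ σ with M σ = n, (X.filter fun x => F x = σ).card := by
  rw [Finset.card_eq_sum_card_fiberwise (f := F) (t := Finset.univ.filter fun σ => M σ = n)]
  · refine Finset.sum_congr rfl fun σ hσ => ?_
    rw [Finset.filter_filter]
    congr 1
    refine Finset.filter_congr fun x hx => ⟨fun h => h.2, fun h1 => ⟨?_, h1⟩⟩
    rw [← h x hx, h1]
    exact (Finset.mem_filter.1 hσ).2
  · intro x hx
    rw [Finset.mem_coe, Finset.mem_filter] at hx
    simpa [h x hx.1] using hx.2

variable {A : Type*} [CommRing A]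
variable {R : Type*} [Field R] [LinearOrder R] [IsStrictOrderedRing R]

omit [IsStrictOrderedRing R] in
theorem onDerPlus_eq_of_signPattern_eq {φ φ' : A →+* R} {Q : Finset A[X]} (P : Q) {x y : R}
    (hx : (P.1.map φ).eval x = 0) (hy : (P.1.map φ').eval y = 0)
    (h : signPattern φ P.1 x = signPattern φ' P.1 y) :
    onDerPlus (signsAt φ Q x) P = onDerPlus (signsAt φ' Q y) P := by
  funext ⟨q, hq⟩
  rcases hq with rfl | ⟨i, h1, h2, rfl⟩
  · change SignType.sign ((P.1.map φ).eval x) = SignType.sign ((P.1.map φ').eval y)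
    rw [hx, hy]
  · change SignType.sign (((derivative^[i] P.1).map φ).eval x) =
      SignType.sign (((derivative^[i] P.1).map φ').eval y)
    have h3 := congrFun h ⟨i - 1, by omega⟩
    simp only [signPattern, Nat.sub_add_cancel h1] at h3
    rwa [← iterate_derivative_map, ← iterate_derivative_map]

variable [IsRealClosed R]

theorem thomLT_of_lt (φ : A →+* R) {Q : Finset A[X]} (hQ : ∀ P ∈ Q, P.Monic) (P : Q) {x y : R}
    (hxy : x < y) (h : (P.1.map φ).eval x = 0 ∨ (P.1.map φ).eval y = 0) :
    ThomLT P.1 (onDerPlus (signsAt φ Q x) P) (onDerPlus (signsAt φ Q y) P) := by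
  rcases eq_or_thomLT_of_lt φ hQ P hxy with ⟨-, h1, h2⟩ | h1
  · exact absurd h (by simp [h1, h2])
  · exact h1

/-- A root is determined by its Thom encoding. -/
theorem eq_of_onDerPlus_eq (φ : A →+* R) {Q : Finset A[X]} (hQ : ∀ P ∈ Q, P.Monic) (P : Q)
    {x y : R} (hx : (P.1.map φ).eval x = 0)
    (h : onDerPlus (signsAt φ Q x) P = onDerPlus (signsAt φ Q y) P) : x = y := by
  rcases lt_trichotomy x y with hxy | hxy | hxy
  · have := thomLT_of_lt φ hQ P hxy (Or.inl hx)
    rw [h] at this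
    exact absurd this this.asymm
  · exact hxy
  · have := thomLT_of_lt φ hQ P hxy (Or.inr hx)
    rw [h] at this
    exact absurd this this.asymm

variable {φ φ' : A →+* R} {Q : Finset A[X]} (hQ : ∀ P ∈ Q, P.Monic)
  (hs : ∀ f ∈ elimFamily Q, SignType.sign (φ f) = SignType.sign (φ' f))
include hQ hs

/-- Equal counts give a root `y` of the other specialization with the derivative pattern of `x`. By
Thom's lemma each is alone in its pattern class, so the sum of the signs of `q` over the class is
the single sign of `q` at `x`, respectively at `y`. This settles the `q` outside `Der₊(P)`. -/
theorem exists_signsAt_eq {P : A[X]} (hP : P ∈ Q) {x : R} (hx : (P.map φ).eval x = 0) :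
    ∃ y, signsAt φ' Q y = signsAt φ Q x := by
  classical
  have hmem : ∀ (ψ : A →+* R) (z : R), z ∈ (P.map ψ).roots.toFinset ↔ (P.map ψ).eval z = 0 :=
    fun ψ z => by rw [Multiset.mem_toFinset, mem_roots ((hQ P hP).map ψ).ne_zero, IsRoot]
  have hx' := (hmem φ x).2 hx
  obtain ⟨y, hy⟩ : ((P.map φ').roots.toFinset.filter fun y =>
      signPattern φ' P y = signPattern φ P x).Nonempty := by
    rw [← Finset.card_pos, ← card_signPattern_eq hQ hs hP, Finset.card_pos]
    exact ⟨x, Finset.mem_filter.2 ⟨hx', rfl⟩⟩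
  rw [Finset.mem_filter] at hy
  obtain ⟨hy', hyx⟩ := hy
  have hy := (hmem φ' y).1 hy'
  have hxy := onDerPlus_eq_of_signPattern_eq ⟨P, hP⟩ hx hy hyx.symm
  refine ⟨y, funext fun q => ?_⟩
  by_cases hq : q.1 ∈ derPlus P
  · exact (congrFun hxy ⟨q.1, hq⟩).symm
  · have h1 := sum_sign_signPattern_eq hQ hs hP ⟨q.2, hq⟩ (signPattern φ P x)
    have hfx : ((P.map φ).roots.toFinset.filter fun z => signPattern φ P z = signPattern φ P x) =
        {x} := by
      ext z
      rw [Finset.mem_filter, Finset.mem_singleton, hmem]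
      refine ⟨fun h => ?_, by rintro rfl; exact ⟨hx, rfl⟩⟩
      exact eq_of_onDerPlus_eq φ hQ ⟨P, hP⟩ h.1 (onDerPlus_eq_of_signPattern_eq ⟨P, hP⟩ h.1 hx h.2)
    have hfy : ((P.map φ').roots.toFinset.filter fun z => signPattern φ' P z = signPattern φ P x) =
        {y} := by
      ext z
      rw [Finset.mem_filter, Finset.mem_singleton, hmem]
      refine ⟨fun h => ?_, by rintro rfl; exact ⟨hy, hyx⟩⟩
      exact eq_of_onDerPlus_eq φ' hQ ⟨P, hP⟩ h.1
        (onDerPlus_eq_of_signPattern_eq ⟨P, hP⟩ h.1 hy (h.2.trans hyx.symm))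
    rw [hfx, hfy, Finset.sum_singleton, Finset.sum_singleton] at h1
    have hinj : ∀ a b : SignType, (a : ℤ) = b → b = a := by decide
    exact hinj _ _ h1

/-- Multiplicity is a function of the derivative pattern, so complex and real roots of multiplicity
`n` are equally many on both sides; half their difference counts the upper roots. -/
theorem card_upperRoots_cxMult_eq {P : A[X]} (hP : P ∈ Q) (n : ℕ) :
    ((upperRoots (P.map φ)).filter fun z => cxMult (P.map φ) z = n).card =
      ((upperRoots (P.map φ')).filter fun z => cxMult (P.map φ') z = n).card := by
  classical
  have hm := hQ P hP
  have hreal : ((P.map φ).roots.toFinset.filter fun x => (P.map φ).rootMultiplicity x = n).card =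
      ((P.map φ').roots.toFinset.filter fun x => (P.map φ').rootMultiplicity x = n).card := by
    have hpm : ∀ (ψ : A →+* R), ∀ x ∈ (P.map ψ).roots.toFinset,
        patternMult (signPattern ψ P x) = (P.map ψ).rootMultiplicity x := fun ψ x hx => by
      rw [Multiset.mem_toFinset, mem_roots (hm.map ψ).ne_zero] at hx
      exact patternMult_signPattern ψ hm hx
    rw [card_filter_eq_sum_card_fiber _ _ _ _ (hpm φ),
      card_filter_eq_sum_card_fiber _ _ _ _ (hpm φ')]
    exact Finset.sum_congr rfl fun σ _ => card_signPattern_eq hQ hs hP σ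
  have hcx : ((cxRoots (P.map φ)).filter fun x => cxMult (P.map φ) x = n).card =
      ((cxRoots (P.map φ')).filter fun x => cxMult (P.map φ') x = n).card := by
    have hpm : ∀ (ψ : A →+* R), ∀ x ∈ cxRoots (P.map ψ),
        patternMult (zeroPattern ψ P x) = cxMult (P.map ψ) x := fun ψ x hx => by
      rw [mem_cxRoots (hm.map ψ).ne_zero] at hx
      exact patternMult_zeroPattern ψ hm hx
    rw [card_filter_eq_sum_card_fiber _ _ _ _ (hpm φ),
      card_filter_eq_sum_card_fiber _ _ _ _ (hpm φ')]
    exact Finset.sum_congr rfl fun σ _ => card_zeroPattern_eq hQ hs hP σ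
  have hsplit : ∀ ψ : A →+* R,
      ((cxRoots (P.map ψ)).filter fun x => cxMult (P.map ψ) x = n).card =
        ((P.map ψ).roots.toFinset.filter fun x => (P.map ψ).rootMultiplicity x = n).card +
          2 * ((upperRoots (P.map ψ)).filter fun x => cxMult (P.map ψ) x = n).card := fun ψ => by
    simp only [Finset.card_filter]
    rw [sum_cxRoots (hm.map ψ).ne_zero, two_mul]
    simp only [cxMult_star, cxMult_algebraMap]
  have h1 := hsplit φ
  have h2 := hsplit φ'
  omega

end Transfer

/-! ### The ordered list of real roots of the whole family. -/

section Descriptions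

variable {A : Type*} [CommRing A]
variable {R : Type*} [Field R] [LinearOrder R] [IsStrictOrderedRing R]

/-- `θ` is the increasing list of the roots of the specialized family, and `η` is the list of
their sign conditions. -/
structure Describes (φ : A →+* R) (Q : Finset A[X]) (η : List (SignCond (derPlusFamily Q)))
    (θ : Fin η.length → R) : Prop where
  strictMono : StrictMono θ
  get_eq : ∀ j, η.get j = signsAt φ Q (θ j)
  exists_iff : ∀ x, (∃ j, θ j = x) ↔ ∃ P ∈ Q, (P.map φ).eval x = 0

omit [IsStrictOrderedRing R] in
theorem Describes.signOf_eq_zero_iff {φ : A →+* R} {Q : Finset A[X]}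
    {η : List (SignCond (derPlusFamily Q))} {θ : Fin η.length → R} (h : Describes φ Q η θ)
    (j : Fin η.length) (P : Q) :
    signOf (η.get j) P = 0 ↔ (P.1.map φ).eval (θ j) = 0 := by
  rw [h.get_eq, signOf_signsAt, sign_eq_zero_iff]

omit [IsStrictOrderedRing R] in
theorem exists_describes (φ : A →+* R) {Q : Finset A[X]} (hQ : ∀ P ∈ Q, P.Monic) :
    ∃ η θ, Describes φ Q η θ := by
  classical
  let S : Finset R := Q.biUnion fun P => (P.map φ).roots.toFinset
  have hS : ∀ x, x ∈ S ↔ ∃ P ∈ Q, (P.map φ).eval x = 0 := fun x => by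
    simp only [S, Finset.mem_biUnion, Multiset.mem_toFinset]
    exact exists_congr fun P => and_congr_right fun hP => by
      rw [mem_roots ((hQ P hP).map φ).ne_zero, IsRoot]
  let e := S.orderEmbOfFin rfl
  let η := List.ofFn fun j => signsAt φ Q (e j)
  have hlen : η.length = S.card := List.length_ofFn
  refine ⟨η, fun j => e (j.cast hlen), fun i j hij => e.strictMono (by simpa using hij),
    fun j => List.get_ofFn _ _, fun x => ?_⟩
  rw [← hS]
  have h1 : x ∈ S ↔ x ∈ Set.range e := by rw [Finset.range_orderEmbOfFin]; rfl
  rw [h1]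
  exact ⟨fun ⟨j, hj⟩ => ⟨_, hj⟩, fun ⟨j, hj⟩ => ⟨j.cast hlen.symm, hj⟩⟩

variable [IsRealClosed R]

theorem Describes.mem_rootLists {φ : A →+* R} {Q : Finset A[X]} (hQ : ∀ P ∈ Q, P.Monic)
    {η : List (SignCond (derPlusFamily Q))} {θ : Fin η.length → R} (h : Describes φ Q η θ) :
    η ∈ rootLists Q := by
  have hroot : ∀ j, ∃ P : Q, (P.1.map φ).eval (θ j) = 0 := fun j => by
    obtain ⟨P, hP, h1⟩ := (h.exists_iff _).1 ⟨j, rfl⟩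
    exact ⟨⟨P, hP⟩, h1⟩
  refine ⟨List.nodup_iff_injective_get.2 fun i j hij => ?_, fun j => ?_, fun j P hj => ⟨?_, ?_⟩, ?_⟩
  · obtain ⟨P, hP⟩ := hroot i
    rw [h.get_eq, h.get_eq] at hij
    exact h.strictMono.injective (eq_of_onDerPlus_eq φ hQ P hP (by rw [hij]))
  · obtain ⟨P, hP⟩ := hroot j
    exact ⟨P, (h.signOf_eq_zero_iff j P).2 hP⟩
  · intro j' hj'
    rw [h.get_eq, h.get_eq]
    exact thomLT_of_lt φ hQ P (h.strictMono hj') (Or.inr ((h.signOf_eq_zero_iff j P).1 hj))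
  · intro j' hj'
    rw [h.get_eq, h.get_eq]
    exact thomLT_of_lt φ hQ P (h.strictMono hj') (Or.inl ((h.signOf_eq_zero_iff j P).1 hj))
  · intro j j' hjj' P
    rw [h.get_eq, h.get_eq]
    exact (eq_or_thomLT_of_lt φ hQ P (h.strictMono hjj')).imp (fun h => h.1) id

/-- Each root is matched with one having the same signs. The encodings of consecutive roots are
comparable for `≺_P`, which forces the order of their partners. -/
theorem Describes.transfer {φ φ' : A →+* R} {Q : Finset A[X]} (hQ : ∀ P ∈ Q, P.Monic)
    (hs : ∀ f ∈ elimFamily Q, SignType.sign (φ f) = SignType.sign (φ' f))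
    {η : List (SignCond (derPlusFamily Q))} {θ : Fin η.length → R} (h : Describes φ Q η θ) :
    ∃ θ', Describes φ' Q η θ' := by
  have hroot : ∀ j, ∃ P : Q, (P.1.map φ).eval (θ j) = 0 := fun j => by
    obtain ⟨P, hP, h1⟩ := (h.exists_iff _).1 ⟨j, rfl⟩
    exact ⟨⟨P, hP⟩, h1⟩
  choose P hP using hroot
  choose θ' hθ' using fun j => exists_signsAt_eq hQ hs (P j).2 (hP j)
  have hP' : ∀ (j) (P : Q), (P.1.map φ).eval (θ j) = 0 → (P.1.map φ').eval (θ' j) = 0 :=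
    fun j P h1 => by
      rw [← sign_eq_zero_iff, ← signOf_signsAt, hθ', signOf_signsAt, h1, sign_zero]
  refine ⟨θ', fun j j' hjj' => ?_, fun j => (h.get_eq j).trans (hθ' j).symm, fun x =>
    ⟨?_, fun ⟨P', hP₁, hx⟩ => ?_⟩⟩
  · have h1 := thomLT_of_lt φ hQ (P j) (h.strictMono hjj') (Or.inl (hP j))
    rw [← hθ', ← hθ'] at h1
    rcases lt_trichotomy (θ' j) (θ' j') with h2 | h2 | h2
    · exact h2
    · rw [h2] at h1; exact absurd h1 h1.asymm
    · exact absurd h1 (thomLT_of_lt φ' hQ (P j) h2 (Or.inr (hP' j _ (hP j)))).asymm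
  · rintro ⟨j, rfl⟩
    exact ⟨P j, (P j).2, hP' j _ (hP j)⟩
  -- No root of the second specialization is missed: match it back to the first with the roles
  -- exchanged, and use that a root is determined by its encoding.
  · obtain ⟨y, hy⟩ := exists_signsAt_eq hQ (fun f hf => (hs f hf).symm) hP₁ hx
    have hy0 : (P'.map φ).eval y = 0 := by
      rw [← sign_eq_zero_iff, ← signOf_signsAt φ y ⟨P', hP₁⟩, hy, signOf_signsAt, hx, sign_zero]
    obtain ⟨j, rfl⟩ := (h.exists_iff y).2 ⟨P', hP₁, hy0⟩
    refine ⟨j, eq_of_onDerPlus_eq φ' hQ (P j) (hP' j _ (hP j)) ?_⟩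
    rw [hθ', hy]

end Descriptions

/-! ### The factorization -/

section Lists

/-- Neither totality nor transitivity of `r` is assumed, because the relation used later is the
strict `≺_P^mu`. Compatibility of `r` with the comparison of `g` is enough to sort `g`. -/
theorem pairwise_insertionSort_of_imp {ι : Type*} (r : ι → ι → Prop) [DecidableRel r] (g : ι → ℕ)
    (h1 : ∀ a b, r a b → g b ≤ g a) (h2 : ∀ a b, ¬ r a b → g a ≤ g b) (l : List ι) :
    (l.insertionSort r).Pairwise fun a b => g b ≤ g a := by
  have hins : ∀ (a : ι) (l : List ι), (l.Pairwise fun a b => g b ≤ g a) →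
      ((l.orderedInsert r a).Pairwise fun a b => g b ≤ g a) := by
    intro a l
    induction l with
    | nil => simp
    | cons b l ih =>
      intro h
      rw [List.pairwise_cons] at h
      by_cases hab : r a b
      · rw [List.orderedInsert_cons_of_le _ _ hab, List.pairwise_cons, List.pairwise_cons]
        refine ⟨fun c hc => ?_, h⟩
        rcases List.mem_cons.1 hc with rfl | hc
        · exact h1 _ _ hab
        · exact (h.1 c hc).trans (h1 _ _ hab)
      · rw [List.orderedInsert_of_not_le _ _ hab, List.pairwise_cons]
        refine ⟨fun c hc => ?_, ih h.2⟩
        rcases (List.mem_orderedInsert r).1 hc with rfl | hc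
        · exact h2 _ _ hab
        · exact h.1 c hc
  induction l with
  | nil => simp
  | cons a l ih => exact hins a _ ih

theorem map_insertionSort_eq {ι : Type*} (r : ι → ι → Prop) [DecidableRel r] (g : ι → ℕ)
    (h1 : ∀ a b, r a b → g b ≤ g a) (h2 : ∀ a b, ¬ r a b → g a ≤ g b) (l : List ι) :
    (l.insertionSort r).map g = (l.map g).insertionSort (· ≥ ·) := by
  refine List.Perm.eq_of_pairwise (le := (· ≥ ·)) (fun a b _ _ hab hba => le_antisymm hba hab)
    ?_ (List.pairwise_insertionSort _ _) ?_
  · exact List.pairwise_map.2 (pairwise_insertionSort_of_imp r g h1 h2 l)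
  · exact ((List.perm_insertionSort r l).map g).trans (List.perm_insertionSort _ _).symm

theorem exists_enumeration {ι : Type*} (s : Finset ι) (g : ι → ℕ) (l : List ℕ)
    (hl : l.Pairwise (· ≥ ·)) (hs : (l : Multiset ℕ) = s.val.map g) :
    ∃ e : Fin l.length → ι, Function.Injective e ∧ (∀ x, x ∈ s ↔ ∃ i, e i = x) ∧
      ∀ i, g (e i) = l.get i := by
  classical
  let m := s.toList.insertionSort fun a b => g b ≤ g a
  have hperm : m.Perm s.toList := List.perm_insertionSort _ _
  have hm : m.map g = l := by
    refine List.Perm.eq_of_pairwise (le := (· ≥ ·)) (fun a b _ _ hab hba => le_antisymm hba hab)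
      ?_ hl ?_
    · exact List.pairwise_map.2 (pairwise_insertionSort_of_imp _ g (fun _ _ h => h)
        (fun _ _ h => (not_le.1 h).le) _)
    · refine (hperm.map g).trans (Multiset.coe_eq_coe.1 ?_)
      rw [hs, ← Multiset.map_coe, Finset.coe_toList]
  have hlen : l.length = m.length := by rw [← hm, List.length_map]
  have hnd : m.Nodup := hperm.nodup_iff.2 s.nodup_toList
  refine ⟨fun i => m.get (i.cast hlen), fun i j hij => ?_, fun x => ?_, fun i => ?_⟩
  · simpa using List.nodup_iff_injective_get.1 hnd hij
  · rw [← Finset.mem_toList, ← hperm.mem_iff, List.mem_iff_get]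
    exact ⟨fun ⟨i, hi⟩ => ⟨i.cast hlen.symm, hi⟩, fun ⟨i, hi⟩ => ⟨_, hi⟩⟩
  · subst hm
    simp

end Lists

/-! ### Factorizations with prescribed multiplicities. -/

section Factorization

variable {A : Type*} [CommRing A]
variable {R : Type*} [Field R] [LinearOrder R] [IsStrictOrderedRing R]

/-- The multiplicities of the pairs of conjugate roots, in non-increasing order. -/
def conjMults (f : R[X]) : List ℕ := ((upperRoots f).val.map (cxMult f)).sort (· ≥ ·)

theorem map_quadratic (z : Cx R) : ((X - C z.re) ^ 2 + C z.im ^ 2 : R[X]).map (algebraMap R (Cx R)) =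
    (X - C z) * (X - C (star z)) := by
  have h1 : z + star z = algebraMap R (Cx R) (2 * z.re) := by
    ext <;> simp [two_mul]
  have h2 : z * star z = algebraMap R (Cx R) (z.re ^ 2 + z.im ^ 2) := by
    ext
    · simp [pow_two]
    · simp [pow_two]; ring
  have h3 : (X - C z) * (X - C (star z)) = X ^ 2 - C (z + star z) * X + C (z * star z) := by
    simp only [C_add, C_mul]; ring
  rw [h3, h1, h2]
  simp only [Polynomial.map_add, Polynomial.map_sub, Polynomial.map_pow, map_X, map_C, map_mul,
    map_add, map_pow, map_ofNat]
  ring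

/-- One factor detects `z = w`, the other `z = star w`; the latter is excluded in the upper half
plane. -/
theorem resPair_ne_zero {z w : Cx R} (hz : 0 < z.im) (hw : 0 < w.im) (h : z ≠ w) :
    resPair z.re z.im w.re w.im ≠ 0 := by
  rw [resPair]
  refine mul_ne_zero (fun h0 => h ?_) (ne_of_gt ?_)
  · have h1 : z.re - w.re = 0 := by nlinarith [sq_nonneg (z.re - w.re), sq_nonneg (z.im - w.im)]
    have h2 : z.im - w.im = 0 := by nlinarith [sq_nonneg (z.re - w.re), sq_nonneg (z.im - w.im)]
    ext <;> linarith
  · positivity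

variable [IsRealClosed R]

/-- The factorization of a monic polynomial over a real closed field. -/
theorem eq_prod_roots_mul_prod_upperRoots {f : R[X]} (hf : f.Monic) :
    f = (∏ x ∈ f.roots.toFinset, (X - C x) ^ f.rootMultiplicity x) *
      ∏ z ∈ upperRoots f, ((X - C z.re) ^ 2 + C z.im ^ 2) ^ cxMult f z := by
  apply Polynomial.map_injective _ (FaithfulSMul.algebraMap_injective R (Cx R))
  have h1 : f.map (algebraMap R (Cx R)) = ∏ z ∈ cxRoots f, (X - C z) ^ cxMult f z := by
    conv_lhs => rw [(IsAlgClosed.splits (f.map (algebraMap R (Cx R)))).eq_prod_roots_of_monic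
      (hf.map _), Finset.prod_multiset_map_count]
    simp only [count_roots]
    rfl
  rw [h1, prod_cxRoots hf.ne_zero, Polynomial.map_mul, Polynomial.map_prod, Polynomial.map_prod,
    ← Finset.prod_mul_distrib]
  congr 1
  · simp [cxMult_algebraMap]
  · refine Finset.prod_congr rfl fun z _ => ?_
    rw [cxMult_star, Polynomial.map_pow, map_quadratic, mul_pow]

theorem sum_rootMultiplicity_add {f : R[X]} (hf : f.Monic) :
    ∑ x ∈ f.roots.toFinset, f.rootMultiplicity x + 2 * (conjMults f).sum = f.natDegree := by
  have h1 : (conjMults f).sum = ∑ z ∈ upperRoots f, cxMult f z := by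
    rw [conjMults, ← Multiset.sum_coe, Multiset.sort_eq]; rfl
  have hq : ∀ a b : R, ((X - C a) ^ 2 + C b ^ 2 : R[X]).Monic := fun a b => by monicity!
  have hqd : ∀ a b : R, ((X - C a) ^ 2 + C b ^ 2 : R[X]).natDegree = 2 := fun a b => by
    compute_degree!
  conv_rhs => rw [eq_prod_roots_mul_prod_upperRoots hf]
  rw [h1, (monic_prod_of_monic _ _ fun x _ => (monic_X_sub_C x).pow _).natDegree_mul
      (monic_prod_of_monic _ _ fun z _ => (hq _ _).pow _),
    natDegree_prod_of_monic _ _ (fun x _ => (monic_X_sub_C x).pow _),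
    natDegree_prod_of_monic _ _ (fun z _ => (hq _ _).pow _), Finset.mul_sum]
  congr 1
  · exact Finset.sum_congr rfl fun x _ => by rw [(monic_X_sub_C x).natDegree_pow]; simp
  · exact Finset.sum_congr rfl fun z _ => by rw [(hq _ _).natDegree_pow, hqd, mul_comm]

theorem conjMults_eq {φ φ' : A →+* R} {Q : Finset A[X]} (hQ : ∀ P ∈ Q, P.Monic)
    (hs : ∀ f ∈ elimFamily Q, SignType.sign (φ f) = SignType.sign (φ' f)) {P : A[X]} (hP : P ∈ Q) :
    conjMults (P.map φ) = conjMults (P.map φ') := by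
  rw [conjMults, conjMults]
  congr 1
  ext n
  rw [Multiset.count_map, Multiset.count_map]
  have h := card_upperRoots_cxMult_eq hQ hs hP n
  simp only [eq_comm (a := n)]
  exact h

variable {φ : A →+* R} {Q : Finset A[X]} (hQ : ∀ P ∈ Q, P.Monic)
  {η : List (SignCond (derPlusFamily Q))} {θ : Fin η.length → R} (h : Describes φ Q η θ)
include hQ h

omit [IsStrictOrderedRing R] [IsRealClosed R] in
theorem Describes.mem_rootIndices (P : Q) (j : Fin η.length) :
    j ∈ rootIndices η P ↔ θ j ∈ (P.1.map φ).roots.toFinset := by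
  rw [rootIndices, List.mem_filter, decide_eq_true_iff, h.signOf_eq_zero_iff,
    Multiset.mem_toFinset, mem_roots ((hQ P.1 P.2).map φ).ne_zero, IsRoot]
  simp

omit [IsRealClosed R] in
theorem Describes.mult_get (P : Q) {j : Fin η.length} (hj : j ∈ rootIndices η P) :
    mult P.1 (onDer (η.get j) P) = (P.1.map φ).rootMultiplicity (θ j) := by
  rw [h.mem_rootIndices hQ, Multiset.mem_toFinset,
    mem_roots ((hQ P.1 P.2).map φ).ne_zero, IsRoot] at hj
  rw [h.get_eq, mult_onDer φ hQ P hj]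

omit hQ h in
theorem mem_sortedIndices (η : List (SignCond (derPlusFamily Q))) (P : Q) (j : Fin η.length) :
    j ∈ sortedIndices η P ↔ j ∈ rootIndices η P := by
  rw [sortedIndices, List.mem_insertionSort]

omit hQ h in
-- The order `≺_P^mu` puts larger multiplicities first, so the sorted vector `vmu` lists entry by
-- entry the multiplicities of the roots in `sortedIndices`. This pairs exponents with roots in
-- `FactSystem`.
theorem vmu_rootsOf_eq (η : List (SignCond (derPlusFamily Q))) (P : Q) :
    vmu P.1 (rootsOf η P) =
      (sortedIndices η P).map fun j => mult P.1 (onDer (η.get j) P) := by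
  classical
  rw [sortedIndices, map_insertionSort_eq]
  · rw [vmu, rootsOf, List.map_map]; rfl
  · rintro a b (h1 | h1)
    · exact h1.le
    · exact h1.1.ge
  · intro a b h1
    exact not_lt.1 fun h2 => h1 (Or.inl h2)

omit [IsStrictOrderedRing R] [IsRealClosed R] in
theorem Describes.image_sortedIndices (P : Q) :
    (sortedIndices η P).toFinset.image θ = (P.1.map φ).roots.toFinset := by
  classical
  ext x
  simp only [Finset.mem_image, List.mem_toFinset, mem_sortedIndices]
  refine ⟨?_, fun hx => ?_⟩
  · rintro ⟨j, hj, rfl⟩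
    exact (h.mem_rootIndices hQ P j).1 hj
  · have hx' := hx
    rw [Multiset.mem_toFinset, mem_roots ((hQ P.1 P.2).map φ).ne_zero, IsRoot] at hx'
    obtain ⟨j, rfl⟩ := (h.exists_iff x).2 ⟨P.1, P.2, hx'⟩
    exact ⟨j, (h.mem_rootIndices hQ P j).2 hx, rfl⟩

omit hQ h in
theorem nodup_sortedIndices (η : List (SignCond (derPlusFamily Q))) (P : Q) :
    (sortedIndices η P).Nodup := by
  classical
  exact (List.perm_insertionSort _ _).nodup_iff.2 ((List.nodup_finRange _).filter _)

omit [IsRealClosed R] in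
theorem Describes.sum_vmu (P : Q) : (vmu P.1 (rootsOf η P)).sum =
    ∑ x ∈ (P.1.map φ).roots.toFinset, (P.1.map φ).rootMultiplicity x := by
  rw [vmu_rootsOf_eq, ← List.sum_toFinset _ (nodup_sortedIndices η P),
    ← h.image_sortedIndices hQ P, Finset.sum_image h.strictMono.injective.injOn]
  refine Finset.sum_congr rfl fun j hj => h.mult_get hQ P ?_
  rwa [List.mem_toFinset, mem_sortedIndices] at hj

theorem Describes.mem_complexMults : (fun P : Q => conjMults (P.1.map φ)) ∈ complexMults Q η := by
  intro P
  refine ⟨_, ?_, Multiset.pairwise_sort _ _, fun m hm => ?_, rfl⟩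
  · rw [h.sum_vmu hQ, sum_rootMultiplicity_add ((hQ P.1 P.2).map φ), (hQ P.1 P.2).natDegree_map]
  · change m ∈ conjMults _ at hm
    rw [conjMults, Multiset.mem_sort, Multiset.mem_map] at hm
    obtain ⟨z, hz, rfl⟩ := hm
    have hf := ((hQ P.1 P.2).map φ).ne_zero
    exact cxMult_pos hf ((mem_upperRoots hf).1 hz).1

theorem Describes.exists_factSystem (P : Q) : ∃ a b : Fin (conjMults (P.1.map φ)).length → R,
    FactSystem (P.1.map φ) (vmu P.1 (rootsOf η P)) (conjMults (P.1.map φ))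
      (fun i => θ ((sortedIndices η P).get (i.cast (length_vmu_rootsOf η P)))) a b := by
  classical
  have hm := (hQ P.1 P.2).map φ
  obtain ⟨e, he, hes, heg⟩ := exists_enumeration (upperRoots (P.1.map φ)) (cxMult (P.1.map φ))
    (conjMults (P.1.map φ)) (Multiset.pairwise_sort _ _) (Multiset.sort_eq _ _)
  have hup : ∀ i, 0 < (e i).im := fun i =>
    ((mem_upperRoots hm.ne_zero).1 ((hes _).2 ⟨i, rfl⟩)).2
  have hget : ∀ i, (vmu P.1 (rootsOf η P)).get i = (P.1.map φ).rootMultiplicity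
      (θ ((sortedIndices η P).get (i.cast (length_vmu_rootsOf η P)))) := fun i => by
    rw [← h.mult_get hQ P]
    · simp [vmu_rootsOf_eq]
    · exact (mem_sortedIndices η P _).1 (List.get_mem _ _)
  have hnd := List.nodup_iff_injective_get.1 (nodup_sortedIndices η P)
  refine ⟨fun i => (e i).re, fun i => (e i).im, ?_, fun j j' hjj' heq => ?_,
    fun k => (hup k).ne', fun k k' hkk' => ?_⟩
  · conv_lhs => rw [eq_prod_roots_mul_prod_upperRoots hm]
    congr 1
    · rw [← h.image_sortedIndices hQ P, Finset.prod_image h.strictMono.injective.injOn]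
      simp only [hget]
      refine (Finset.prod_bij (fun i _ => (sortedIndices η P).get
        (i.cast (length_vmu_rootsOf η P))) (fun i _ => ?_) (fun i _ j _ hij => ?_)
        (fun j hj => ?_) fun i _ => rfl).symm
      · rw [List.mem_toFinset]; exact List.get_mem _ _
      · simpa using hnd hij
      · rw [List.mem_toFinset, List.mem_iff_get] at hj
        obtain ⟨i, rfl⟩ := hj
        exact ⟨i.cast (length_vmu_rootsOf η P).symm, Finset.mem_univ _, rfl⟩
    · refine (Finset.prod_bij (fun i _ => e i) (fun i _ => (hes _).2 ⟨i, rfl⟩)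
        (fun i _ j _ hij => he hij) (fun z hz => ?_) fun i _ => ?_).symm
      · obtain ⟨i, rfl⟩ := (hes z).1 hz
        exact ⟨i, Finset.mem_univ _, rfl⟩
      · rw [heg]
  · have := hnd (h.strictMono.injective heq)
    simp at this
    exact hjj'.ne this
  · exact resPair_ne_zero (hup k) (hup k') fun heq => hkk'.ne (he heq)

end Factorization

end

end RootOrder

/-! ### The theorem: descriptions are read off at one parameter and transferred to all others. -/

theorem mainTheorem6 {K : Type*} [Field K] [LinearOrder K] [IsStrictOrderedRing K]
    {R : Type*} [Field R] [LinearOrder R] [IsStrictOrderedRing R] [IsRealClosed R]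
    [Algebra K R] (hKR : StrictMono (algebraMap K R)) (k : ℕ)
    (Q : Finset (Polynomial (MvPolynomial (Fin k) K))) (hQ : ∀ P ∈ Q, P.Monic)
    (τ : SignCond (elimFamily Q)) (hτ : (realization R τ).Nonempty) :
    ∃ η ∈ rootLists Q, ∃ ν ∈ complexMults Q η, ∀ υ ∈ realization R τ,
      ∃ (θ : Fin η.length → R) (α β : (P : Q) → Fin (ν P).length → R),
        OFact Q η ν υ θ α β := by
  obtain ⟨υ₀, hυ₀⟩ := hτ
  let φ : (Fin k → R) → (MvPolynomial (Fin k) K →+* R) := fun υ =>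
    (MvPolynomial.aeval υ : MvPolynomial (Fin k) K →ₐ[K] R).toRingHom
  obtain ⟨η, θ₀, h₀⟩ := exists_describes (φ υ₀) hQ
  refine ⟨η, h₀.mem_rootLists hQ, _, h₀.mem_complexMults hQ, fun υ hυ => ?_⟩
  have hs : ∀ f ∈ elimFamily Q, SignType.sign (φ υ₀ f) = SignType.sign (φ υ f) := fun f hf =>
    (hυ₀ ⟨f, hf⟩).trans (hυ ⟨f, hf⟩).symm
  obtain ⟨θ, h⟩ := h₀.transfer hQ hs
  have hfact : ∀ P : Q, ∃ a b : Fin (conjMults (P.1.map (φ υ₀))).length → R,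
      FactSystem (P.1.map (φ υ)) (vmu P.1 (rootsOf η P)) (conjMults (P.1.map (φ υ₀)))
        (fun i => θ ((sortedIndices η P).get (i.cast (length_vmu_rootsOf η P)))) a b := fun P => by
    -- The vector `ν` comes from `υ₀`; it equals the one at `υ`, where the factorization is
    -- available.
    rw [conjMults_eq hQ hs P.2]
    exact h.exists_factSystem hQ P
  choose a b hab using hfact
  exact ⟨θ, a, b, hab, fun j j' hjj' => h.strictMono hjj'⟩
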